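/- Let $d\in\mathbb N$, let $\Lambda$ be an index set, and let $\{\psi_\lambda\}_{\lambda\in\Lambda}\subset L^2(\mathbb R^d)$ be real-valued functions. With $\hat f(\xi)=\int_{\mathbb R^d} f(x)e^{-2\pi i x\cdot\xi}\,dx$ (extended to $L^2$), put $F_\lambda:=\operatorname{supp}\hat\psi_\lambda$, the complement of the largest open set on which $\hat\psi_\lambda=0$ almost everywhere, and let $|F_\lambda|$ be its Lebesgue measure. Assume: (i) each $F_\lambda$ is compact, and $\{\psi_\lambda(\cdot-u)\}_{u\in\mathbb R^d,\lambda\in\Lambda}$ is a semi-discrete frame, i.e. there are constants $A,B>0$ with $$A\|f\|_2^2\le\sum_{\lambda\in\Lambda}\|f\ast\psi_\lambda\|_2^2\le B\|f\|_2^2\qquad\text{for all } f\in L^2(\mathbb R^d);$$ (ii) (good Fourier-support overlap) there are non-empty open sets $U_\lambda\subseteq F_\lambda$, $\lambda\in\Lambda$, with $\bigcup_{\lambda\in\Lambda}U_\lambda=\mathbb R^d$; (iii) for each $\lambda$, $X_\lambda=\{x_{\lambda,n}\}_{n\in\mathbb Z^d}$ is a sign-blind sampling set for $F_\lambda$: $x_{\lambda,n}=(M_\lambda^{\top})^{-1}\operatorname{diag}(2s_{\lambda,1},\dots,2s_{\lambda,d})^{-1}n$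 with a non-singular real $d\times d$ matrix $M_\lambda$ such that $F_\lambda\subseteq M_\lambda[-\tfrac12,\tfrac12]^d$ and real numbers $s_{\lambda,1},\dots,s_{\lambda,d}\ge1$. Let $C\subset\mathbb R^d$ be compact. Let $L^2(C,\mathbb R)$ be the space of real-valued square-integrable functions on $C$, extended by zero to $\mathbb R^d$, and equip $L^2(C,\mathbb R)/\{-1,1\}$ (identifying $f$ with $-f$) with the metric $\min\{\|f-g\|_{L^2},\|f+g\|_{L^2}\}$. Consider the sampling operator $$T(f)=\bigl(|F_\lambda|^{-1/2}\,|(f\ast\psi_\lambda)(x_{\lambda,n})|\bigr)_{(\lambda,n)\in\Lambda\times\mathbb Z^d}\in\ell^2(\Lambda\times\mathbb Z^d),$$ defined on the set $D(T)$ of all classes $f\in L^2(C,\mathbb R)/\{-1,1\}$ for which this family is square summable. Then: (a) if $\sup_{\lambda\in\Lambda}|F_\lambda|^{-1}\,|\det M_\lambda|\prod_{j=1}^d s_{\lambda,j}<\infty$, then $D(T)=L^2(C,\mathbb R)/\{-1,1\}$; (b) without this assumption, $T:D(T)\to\ell^2(\Lambda\times\mathbb Z^d)$ is injective, its range $\mathcal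 R(T)=T(D(T))$ is closed in $\ell^2(\Lambda\times\mathbb Z^d)$, and the inverse map $T^{-1}:\mathcal R(T)\to L^2(C,\mathbb R)/\{-1,1\}$ is continuous. In particular, whenever $T$ maps all of $L^2(C,\mathbb R)/\{-1,1\}$ into $\ell^2(\Lambda\times\mathbb Z^d)$, it is injective on $L^2(C,\mathbb R)/\{-1,1\}$ with closed range and continuous inverse on its range. -/

import Mathlib

open MeasureTheory Set Topology
open scoped ENNReal FourierTransform

noncomputable section

namespace SignRetrieval

/-! ### The quotient of a normed space by a global sign -/

/-- `f ∼ g` iff `f = ± g`. -/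
def signSetoid (V : Type*) [AddCommGroup V] : Setoid V where
  r f g := f = g ∨ f = -g
  iseqv :=
    { refl := fun _ => Or.inl rfl
      symm := by
        rintro f g (h | h)
        · exact Or.inl h.symm
        · exact Or.inr (by rw [h, neg_neg])
      trans := by
        rintro f g k (h | h) (h' | h')
        · exact Or.inl (h.trans h')
        · exact Or.inr (h.trans h')
        · exact Or.inr (by rw [h, h'])
        · exact Or.inl (by rw [h, h', neg_neg]) }

/-- The quotient `V / {-1, 1}`. -/
def SignQuotient (V : Type*) [AddCommGroup V] : Type _ := Quotient (signSetoid V)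

namespace SignQuotient

/-- The class `{f, -f}` of `f`. -/
def mk {V : Type*} [AddCommGroup V] (f : V) : SignQuotient V := Quotient.mk (signSetoid V) f

theorem eq_or_eq_neg_of_mk_eq {V : Type*} [AddCommGroup V] {f g : V} (h : mk f = mk g) :
    f = g ∨ f = -g :=
  Quotient.exact h

/-- The distance `min (‖f - g‖) (‖f + g‖)` between the classes of `f` and `g`. -/
def signDist {V : Type*} [NormedAddCommGroup V] (p q : SignQuotient V) : ℝ :=
  Quotient.liftOn₂ p q (fun f g => min ‖f - g‖ ‖f + g‖) (by
    rintro f g f' g' (rfl | rfl) (rfl | rfl)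
    · rfl
    · simp only [sub_neg_eq_add, ← sub_eq_add_neg, min_comm]
    · rw [min_comm, show -f' + g = -(f' - g) by abel, show -f' - g = -(f' + g) by abel,
        norm_neg, norm_neg]
    · rw [show -f' - -g' = -(f' - g') by abel, show -f' + -g' = -(f' + g') by abel,
        norm_neg, norm_neg])

instance {V : Type*} [NormedAddCommGroup V] : MetricSpace (SignQuotient V) where
  dist := signDist
  dist_self := by
    rintro ⟨f⟩
    change min ‖f - f‖ ‖f + f‖ = 0
    simp
  dist_comm := by
    rintro ⟨f⟩ ⟨g⟩
    change min ‖f - g‖ ‖f + g‖ = min ‖g - f‖ ‖g + f‖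
    rw [norm_sub_rev, add_comm]
  dist_triangle := by
    rintro ⟨f⟩ ⟨g⟩ ⟨k⟩
    change min ‖f - k‖ ‖f + k‖ ≤ min ‖f - g‖ ‖f + g‖ + min ‖g - k‖ ‖g + k‖
    have h1 : ‖f - k‖ ≤ ‖f - g‖ + ‖g - k‖ := norm_sub_le_norm_sub_add_norm_sub f g k
    have h2 : ‖f + k‖ ≤ ‖f - g‖ + ‖g + k‖ := by
      have := norm_add_le (f - g) (g + k)
      rwa [show f - g + (g + k) = f + k by abel] at this
    have h3 : ‖f + k‖ ≤ ‖f + g‖ + ‖g - k‖ := by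
      have := norm_sub_le (f + g) (g - k)
      rwa [show f + g - (g - k) = f + k by abel] at this
    have h4 : ‖f - k‖ ≤ ‖f + g‖ + ‖g + k‖ := by
      have := norm_sub_le (f + g) (g + k)
      rwa [show f + g - (g + k) = f - k by abel] at this
    have h5 := min_le_left ‖f - k‖ ‖f + k‖
    have h6 := min_le_right ‖f - k‖ ‖f + k‖
    rcases min_choice ‖f - g‖ ‖f + g‖ with h | h <;>
      rcases min_choice ‖g - k‖ ‖g + k‖ with h' | h' <;> rw [h, h'] <;> linarith
  eq_of_dist_eq_zero := by
    rintro ⟨f⟩ ⟨g⟩ h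
    change min ‖f - g‖ ‖f + g‖ = 0 at h
    apply Quotient.sound
    rcases min_choice ‖f - g‖ ‖f + g‖ with h' | h' <;> rw [h'] at h
    · exact Or.inl (sub_eq_zero.1 (norm_eq_zero.1 h))
    · exact Or.inr (eq_neg_of_add_eq_zero_left (norm_eq_zero.1 h))

theorem dist_mk {V : Type*} [NormedAddCommGroup V] (f g : V) :
    dist (mk f) (mk g) = min ‖f - g‖ ‖f + g‖ := rfl

end SignQuotient

/-! ### Semi-discrete frames -/

variable {d : ℕ} {Λ : Type*}

/-- The convolution `f ∗ ψ`, `(f ∗ ψ)(x) = ∫ f(t) ψ(x - t) dt`, of a vector-valued function `f`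
with a real-valued function `ψ`. -/
def conv {V : Type*} [NormedAddCommGroup V] [NormedSpace ℝ V]
    (f : EuclideanSpace ℝ (Fin d) → V) (ψ : EuclideanSpace ℝ (Fin d) → ℝ) :
    EuclideanSpace ℝ (Fin d) → V :=
  convolution f ψ (ContinuousLinearMap.lsmul ℝ ℝ : ℝ →L[ℝ] V →L[ℝ] V).flip volume

/-- The Fourier transform of a real-valued `L²` function, as a complex-valued `L²` function. -/
def fourierL2 (ψ : Lp ℝ 2 (volume : Measure (EuclideanSpace ℝ (Fin d)))) :
    Lp ℂ 2 (volume : Measure (EuclideanSpace ℝ (Fin d))) :=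
  𝓕 (Complex.ofRealCLM.compLp ψ)

/-- The support of an `L²` function: the complement of the largest open set on which it vanishes
almost everywhere. -/
def essSupport (g : Lp ℂ 2 (volume : Measure (EuclideanSpace ℝ (Fin d)))) :
    Set (EuclideanSpace ℝ (Fin d)) :=
  {ξ | ∀ U ∈ 𝓝 ξ, 0 < volume (U ∩ Function.support g)}

/-- `F_ψ = supp ψ̂`. -/
def fourierSupport (ψ : Lp ℝ 2 (volume : Measure (EuclideanSpace ℝ (Fin d)))) :
    Set (EuclideanSpace ℝ (Fin d)) :=
  essSupport (fourierL2 ψ)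

/-- `{ψ_λ(· - u)}` is a semi-discrete frame of real-valued band-limited functions: each `supp ψ̂_λ`
is compact, and `A ‖f‖² ≤ ∑_λ ‖f ∗ ψ_λ‖² ≤ B ‖f‖²` for all `f ∈ L²(ℝᵈ)` and some `A, B > 0`. -/
structure IsBandLimitedFrame
    (ψ : Λ → Lp ℝ 2 (volume : Measure (EuclideanSpace ℝ (Fin d)))) : Prop where
  bandLimited : ∀ l, IsCompact (fourierSupport (ψ l))
  frame : ∃ A B : ℝ, 0 < A ∧ 0 < B ∧
    ∀ f : Lp ℂ 2 (volume : Measure (EuclideanSpace ℝ (Fin d))),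
      ENNReal.ofReal (A * ‖f‖ ^ 2) ≤ ∑' l, eLpNorm (conv f (ψ l)) 2 volume ^ 2 ∧
      ∑' l, eLpNorm (conv f (ψ l)) 2 volume ^ 2 ≤ ENNReal.ofReal (B * ‖f‖ ^ 2)

/-- Good Fourier-support overlap: there are nonempty open sets `U_λ` inside `supp ψ̂_λ` that cover
the whole space. -/
def GoodFSupportOverlap
    (ψ : Λ → Lp ℝ 2 (volume : Measure (EuclideanSpace ℝ (Fin d)))) : Prop :=
  ∃ U : Λ → Set (EuclideanSpace ℝ (Fin d)),
    (∀ l, (U l).Nonempty ∧ IsOpen (U l) ∧ U l ⊆ fourierSupport (ψ l)) ∧ ⋃ l, U l = univ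

/-! ### Sign-blind sampling sets -/

/-- The cube `[-1/2, 1/2]ᵈ`. -/
def cube (d : ℕ) : Set (EuclideanSpace ℝ (Fin d)) := {x | ∀ i, |x i| ≤ 1 / 2}

/-- The point `(Mᵀ)⁻¹ D[2s]⁻¹ n` of the lattice `(Mᵀ)⁻¹ D[2s]⁻¹ ℤᵈ`. -/
def latticePoint (M : Matrix (Fin d) (Fin d) ℝ) (s : Fin d → ℝ) (n : Fin d → ℤ) :
    EuclideanSpace ℝ (Fin d) :=
  WithLp.toLp 2 ((M.transpose)⁻¹.mulVec
    ((Matrix.diagonal fun i => 2 * s i)⁻¹.mulVec fun i => (n i : ℝ)))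

/-- The lattice `(Mᵀ)⁻¹ D[2s]⁻¹ ℤᵈ` is a sign-blind sampling set for `F`. -/
structure IsSignBlind (F : Set (EuclideanSpace ℝ (Fin d)))
    (M : Matrix (Fin d) (Fin d) ℝ) (s : Fin d → ℝ) : Prop where
  det_ne_zero : M.det ≠ 0
  subset : F ⊆ (fun x => Matrix.toEuclideanLin M x) '' cube d
  one_le : ∀ i, 1 ≤ s i

/-! ### The sampling operator -/

/-- `L²(C, ℝ)`. -/
abbrev L2On (C : Set (EuclideanSpace ℝ (Fin d))) : Type :=
  Lp ℝ 2 ((volume : Measure (EuclideanSpace ℝ (Fin d))).restrict C)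

/-- `f ∗ ψ` for `f ∈ L²(C, ℝ)`, extended by zero outside `C`. -/
def convOn {C : Set (EuclideanSpace ℝ (Fin d))} (f : L2On C)
    (ψ : EuclideanSpace ℝ (Fin d) → ℝ) : EuclideanSpace ℝ (Fin d) → ℝ :=
  conv (C.indicator f) ψ

theorem convOn_neg {C : Set (EuclideanSpace ℝ (Fin d))} (hC : MeasurableSet C) (f : L2On C)
    (ψ : EuclideanSpace ℝ (Fin d) → ℝ) (x : EuclideanSpace ℝ (Fin d)) :
    convOn (-f) ψ x = -convOn f ψ x := by
  unfold convOn conv convolution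
  rw [← integral_neg]
  refine integral_congr_ae ?_
  filter_upwards [(ae_restrict_iff' hC).1 (Lp.coeFn_neg f)] with t ht
  by_cases h : t ∈ C
  · rw [indicator_of_mem h, indicator_of_mem h, ht h]
    simp
  · simp [h]

/-- The samples `|F_λ|^{-1/2} |f ∗ ψ_λ|(x_{λ,n})`, `(λ, n) ∈ Λ × ℤᵈ`. -/
def samples (ψ : Λ → Lp ℝ 2 (volume : Measure (EuclideanSpace ℝ (Fin d))))
    (M : Λ → Matrix (Fin d) (Fin d) ℝ) (s : Λ → Fin d → ℝ)
    {C : Set (EuclideanSpace ℝ (Fin d))} (f : L2On C) : Λ × (Fin d → ℤ) → ℝ := fun p =>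
  volume.real (fourierSupport (ψ p.1)) ^ (-(1 / 2) : ℝ) *
    |convOn f (ψ p.1) (latticePoint (M p.1) (s p.1) p.2)|

/-- The samples of a class in `L²(C, ℝ) / {-1, 1}`. -/
def signSamples (ψ : Λ → Lp ℝ 2 (volume : Measure (EuclideanSpace ℝ (Fin d))))
    (M : Λ → Matrix (Fin d) (Fin d) ℝ) (s : Λ → Fin d → ℝ)
    {C : Set (EuclideanSpace ℝ (Fin d))} (hC : IsCompact C) (q : SignQuotient (L2On C)) :
    Λ × (Fin d → ℤ) → ℝ :=
  Quotient.liftOn q (samples ψ M s) (by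
    rintro f g (rfl | rfl)
    · rfl
    · funext p
      simp only [samples, convOn_neg hC.measurableSet, abs_neg])

/-- The classes in `L²(C, ℝ) / {-1, 1}` whose samples are square summable. -/
def samplingDomain (ψ : Λ → Lp ℝ 2 (volume : Measure (EuclideanSpace ℝ (Fin d))))
    (M : Λ → Matrix (Fin d) (Fin d) ℝ) (s : Λ → Fin d → ℝ)
    {C : Set (EuclideanSpace ℝ (Fin d))} (hC : IsCompact C) : Set (SignQuotient (L2On C)) :=
  {q | Memℓp (signSamples ψ M s hC q) 2}

/-- The sampling operator `T`, with values in `ℓ²(Λ × ℤᵈ)`. -/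
def samplingOp (ψ : Λ → Lp ℝ 2 (volume : Measure (EuclideanSpace ℝ (Fin d))))
    (M : Λ → Matrix (Fin d) (Fin d) ℝ) (s : Λ → Fin d → ℝ)
    {C : Set (EuclideanSpace ℝ (Fin d))} (hC : IsCompact C) (q : samplingDomain ψ M s hC) :
    lp (fun _ : Λ × (Fin d → ℤ) => ℝ) 2 :=
  ⟨signSamples ψ M s hC q, q.2⟩

end SignRetrieval

end

namespace SignRetrieval

/-! ### Recovery of a signed expansion from its absolute values -/

section Abstract

open Filter

variable {I : Type*}

theorem tendsto_tsum_sq_sub_of_tendsto_abs {α : Type*} {𝒢 : Filter α} {b : α → I → ℝ} {a h : I → ℝ}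
    (hh : Summable fun i => h i ^ 2) (hah : ∀ i, |a i| = h i)
    (hb : ∀ i, Tendsto (fun x => b x i) 𝒢 (𝓝 (a i)))
    (hs : ∀ᶠ x in 𝒢, Summable fun i => (|b x i| - h i) ^ 2)
    (ht : Tendsto (fun x => ∑' i, (|b x i| - h i) ^ 2) 𝒢 (𝓝 0)) :
    (∀ᶠ x in 𝒢, Summable fun i => (b x i - a i) ^ 2) ∧
      Tendsto (fun x => ∑' i, (b x i - a i) ^ 2) 𝒢 (𝓝 0) := by
  set g : α → I → ℝ := fun x i => max 0 ((b x i - a i) ^ 2 - 2 * (|b x i| - h i) ^ 2) with hg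
  have hg0 : ∀ x i, 0 ≤ g x i := fun x i => le_max_left _ _
  have hgle : ∀ x i, g x i ≤ 8 * h i ^ 2 := by
    intro x i
    refine max_le (by positivity) ?_
    rw [← hah i]
    have h1 : |b x i - a i| ≤ |b x i| + |a i| := abs_sub _ _
    have h2 : (b x i - a i) ^ 2 ≤ (|b x i| + |a i|) ^ 2 := by
      rw [← sq_abs]; gcongr
    nlinarith [sq_nonneg (|b x i| - 3 * |a i|)]
  have hdom : Summable fun i => 8 * h i ^ 2 := hh.mul_left 8
  have hgs : ∀ x, Summable (g x) := fun x =>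
    Summable.of_nonneg_of_le (hg0 x) (hgle x) hdom
  have hgt : Tendsto (fun x => ∑' i, g x i) 𝒢 (𝓝 (∑' _ : I, (0 : ℝ))) := by
    refine tendsto_tsum_of_dominated_convergence hdom ?_ ?_
    · intro i
      have h1 : Tendsto (fun x => (b x i - a i) ^ 2 - 2 * (|b x i| - h i) ^ 2) 𝒢
          (𝓝 ((a i - a i) ^ 2 - 2 * (|a i| - h i) ^ 2)) :=
        (((hb i).sub_const _).pow 2).sub (((((hb i).abs).sub_const _).pow 2).const_mul 2)
      have h2 := (tendsto_const_nhds (x := (0 : ℝ))).max h1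
      simpa [hah i] using h2
    · filter_upwards with x i
      rw [Real.norm_of_nonneg (hg0 x i)]
      exact hgle x i
  rw [tsum_zero] at hgt
  have hle : ∀ x i, (b x i - a i) ^ 2 ≤ 2 * (|b x i| - h i) ^ 2 + g x i := fun x i => by
    have := le_max_right 0 ((b x i - a i) ^ 2 - 2 * (|b x i| - h i) ^ 2)
    simp only [hg]
    linarith
  have hsum : ∀ᶠ x in 𝒢, Summable fun i => (b x i - a i) ^ 2 := by
    filter_upwards [hs] with x hx
    exact Summable.of_nonneg_of_le (fun i => sq_nonneg _) (hle x) ((hx.mul_left 2).add (hgs x))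
  refine ⟨hsum, ?_⟩
  have hlim := (ht.const_mul 2).add hgt
  simp only [mul_zero, add_zero] at hlim
  refine tendsto_of_tendsto_of_tendsto_of_le_of_le' tendsto_const_nhds hlim
    (Eventually.of_forall fun x => tsum_nonneg fun i => sq_nonneg _) ?_
  filter_upwards [hs, hsum] with x hx hx'
  rw [← tsum_mul_left, ← (hx.mul_left 2).tsum_add (hgs x)]
  exact hx'.tsum_le_tsum (hle x) ((hx.mul_left 2).add (hgs x))

theorem summable_sq_of_lp (x : lp (fun _ : I => ℝ) 2) : Summable fun i => x i ^ 2 := by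
  have := (lp.memℓp x).summable (by norm_num)
  simpa using this

theorem norm_sq_eq_tsum_of_lp (x : lp (fun _ : I => ℝ) 2) : ‖x‖ ^ 2 = ∑' i, x i ^ 2 := by
  have := lp.norm_rpow_eq_tsum (p := 2) (by norm_num) x
  simpa using this

/-- The absolute values of the coefficients of a lower-bounded family of functionals form a closed
map into `ℓ²`. -/
theorem isClosed_abs_coefficients {V : Type*} [NormedAddCommGroup V] [NormedSpace ℝ V]
    [CompleteSpace V] (φ : I → V →L[ℝ] ℝ) {c : ℝ} (hc : 0 < c)
    (hφ : ∀ f, Summable (fun i => φ i f ^ 2) → c * ‖f‖ ^ 2 ≤ ∑' i, φ i f ^ 2)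
    {A : Set V} (hA : IsClosed A) :
    IsClosed {x : lp (fun _ : I => ℝ) 2 | ∃ f ∈ A, ∀ i, x i = |φ i f|} := by
  refine isClosed_of_closure_subset fun h hh => ?_
  obtain ⟨𝒰, hS, h𝒰⟩ := mem_closure_iff_ultrafilter.1 hh
  classical
  choose! F hFA hF using fun (x : lp (fun _ : I => ℝ) 2)
    (hx : x ∈ {x : lp (fun _ : I => ℝ) 2 | ∃ f ∈ A, ∀ i, x i = |φ i f|}) => hx
  have hcoord : ∀ i, Tendsto (fun x : lp (fun _ : I => ℝ) 2 => |φ i (F x)|) 𝒰 (𝓝 (h i)) := by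
    intro i
    have h1 : Tendsto (fun x : lp (fun _ : I => ℝ) 2 => x i) 𝒰 (𝓝 (h i)) := by
      refine Tendsto.mono_left ?_ h𝒰
      exact (lp.lipschitzWith_one_eval 2 i).continuous.tendsto h
    refine h1.congr' ?_
    filter_upwards [hS] with x hx using hF x hx i
  have hlim : ∀ i, ∃ a, Tendsto (fun x => φ i (F x)) 𝒰 (𝓝 a) := by
    intro i
    have hev : ∀ᶠ x in (𝒰 : Filter _), φ i (F x) ∈ Icc (-(h i + 1)) (h i + 1) := by
      filter_upwards [(hcoord i).eventually (Iio_mem_nhds (lt_add_one (h i)))] with x hx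
      exact abs_le.1 (le_of_lt hx)
    obtain ⟨a, -, ha⟩ := isCompact_Icc.ultrafilter_le_nhds (𝒰.map fun x => φ i (F x))
      (le_principal_iff.2 hev)
    exact ⟨a, ha⟩
  choose a ha using hlim
  have hah : ∀ i, |a i| = h i := fun i => tendsto_nhds_unique (ha i).abs (hcoord i)
  have hdiff : ∀ᶠ x in (𝒰 : Filter _),
      ∀ i, (|φ i (F x)| - h i) ^ 2 = (x - h : lp (fun _ : I => ℝ) 2) i ^ 2 := by
    filter_upwards [hS] with x hx i
    rw [← hF x hx i]; rfl
  obtain ⟨hs, ht⟩ := tendsto_tsum_sq_sub_of_tendsto_abs (𝒢 := (𝒰 : Filter _))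
    (b := fun x i => φ i (F x)) (summable_sq_of_lp h) hah ha
    (by
      filter_upwards [hdiff] with x hx
      simp_rw [hx]
      exact summable_sq_of_lp _)
    (by
      have h1 : Tendsto (fun x => ‖x - h‖ ^ 2) 𝒰 (𝓝 0) := by
        have : Tendsto (fun x => ‖x - h‖ ^ 2) (𝓝 h) (𝓝 (‖h - h‖ ^ 2)) :=
          ((continuous_id.sub continuous_const).norm.pow 2).tendsto h
        simpa using this.mono_left h𝒰
      refine h1.congr' ?_
      filter_upwards [hdiff] with x hx
      simp_rw [hx]
      exact norm_sq_eq_tsum_of_lp _)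
  have hcauchy : Cauchy ((𝒰 : Filter _).map F) := by
    rw [Metric.cauchy_iff]
    refine ⟨inferInstance, fun ε hε => ?_⟩
    have hδ : 0 < c * ε ^ 2 / 4 := by positivity
    refine ⟨_, image_mem_map (hs.and (ht.eventually (Iio_mem_nhds hδ))), ?_⟩
    rintro _ ⟨x, ⟨hx1, hx2⟩, rfl⟩ _ ⟨y, ⟨hy1, hy2⟩, rfl⟩
    have hle : ∀ i, φ i (F x - F y) ^ 2 ≤ 2 * (φ i (F x) - a i) ^ 2 + 2 * (φ i (F y) - a i) ^ 2 :=
      fun i => by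
        rw [map_sub]
        nlinarith [sq_nonneg (φ i (F x) - a i + (φ i (F y) - a i))]
    have hsum := (hx1.mul_left 2).add (hy1.mul_left 2)
    have hsum' : Summable fun i => φ i (F x - F y) ^ 2 :=
      Summable.of_nonneg_of_le (fun i => sq_nonneg _) hle hsum
    have h1 := hφ _ hsum'
    have h2 := hsum'.tsum_le_tsum hle hsum
    rw [(hx1.mul_left 2).tsum_add (hy1.mul_left 2), tsum_mul_left, tsum_mul_left] at h2
    replace hx2 : ∑' i, (φ i (F x) - a i) ^ 2 < c * ε ^ 2 / 4 := hx2
    replace hy2 : ∑' i, (φ i (F y) - a i) ^ 2 < c * ε ^ 2 / 4 := hy2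
    have h3 : ‖F x - F y‖ ^ 2 < ε ^ 2 := by
      refine lt_of_mul_lt_mul_left ?_ hc.le
      linarith
    rw [dist_eq_norm]
    exact lt_of_pow_lt_pow_left₀ 2 hε.le h3
  obtain ⟨f, hf⟩ := CompleteSpace.complete hcauchy
  refine ⟨f, hA.mem_of_tendsto (hf : Tendsto F 𝒰 (𝓝 f)) ?_, fun i => ?_⟩
  · filter_upwards [hS] with x hx using hFA x hx
  · rw [← hah i]
    congr 1
    exact tendsto_nhds_unique (ha i) (((φ i).continuous.tendsto f).comp hf)

end Abstract

/-! ### Functions that are analytic on lines -/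

section Analytic

open Filter

theorem differentiable_integral_cexp {α : Type*} [MeasurableSpace α] {μ : Measure α} {a g : α → ℂ}
    {K : ℝ} (ha : AEStronglyMeasurable a μ) (hg : Integrable g μ)
    (hK : ∀ᵐ x ∂μ, g x ≠ 0 → ‖a x‖ ≤ K) :
    Differentiable ℂ fun z : ℂ => ∫ x, Complex.exp (z * a x) * g x ∂μ := by
  intro z₀
  have hexp : ∀ z : ℂ, AEStronglyMeasurable (fun x => Complex.exp (z * a x)) μ := fun z =>
    Complex.continuous_exp.comp_aestronglyMeasurable (ha.const_mul z)
  have hbd : ∀ z : ℂ, ∀ x, (g x ≠ 0 → ‖a x‖ ≤ K) →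
      ‖Complex.exp (z * a x) * g x‖ ≤ Real.exp (‖z‖ * K) * ‖g x‖ := by
    intro z x hx
    by_cases h : g x = 0
    · simp [h]
    · rw [norm_mul]
      gcongr
      refine (Complex.norm_exp_le_exp_norm _).trans ?_
      rw [norm_mul]
      gcongr
      exact hx h
  refine (hasDerivAt_integral_of_dominated_loc_of_deriv_le (μ := μ)
    (F := fun z x => Complex.exp (z * a x) * g x)
    (F' := fun z x => a x * (Complex.exp (z * a x) * g x))
    (bound := fun x => K * (Real.exp ((‖z₀‖ + 1) * |K|) * ‖g x‖))
    (Metric.ball_mem_nhds z₀ one_pos) ?_ ?_ ?_ ?_ ?_ ?_).2.differentiableAt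
  · exact Eventually.of_forall fun z => (hexp z).mul hg.aestronglyMeasurable
  · refine (hg.norm.const_mul (Real.exp (‖z₀‖ * K))).mono'
      ((hexp z₀).mul hg.aestronglyMeasurable) ?_
    filter_upwards [hK] with x hx using hbd z₀ x hx
  · exact ha.mul ((hexp z₀).mul hg.aestronglyMeasurable)
  · filter_upwards [hK] with x hx z hz
    by_cases h : g x = 0
    · simp [h]
    · rw [norm_mul]
      have hK0 : 0 ≤ K := (norm_nonneg _).trans (hx h)
      gcongr
      · exact hx h
      · refine (hbd z x hx).trans ?_
        have : ‖z‖ ≤ ‖z₀‖ + 1 := by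
          have h1 := norm_le_norm_add_norm_sub' z z₀
          have h2 : ‖z - z₀‖ < 1 := by simpa [dist_eq_norm] using hz
          linarith
        gcongr
        exact le_abs_self K
  · exact (hg.norm.const_mul _).const_mul K
  · filter_upwards with x z hz
    have h1 : HasDerivAt (fun z : ℂ => z * a x) (a x) z := by
      simpa using (hasDerivAt_id z).mul_const (a x)
    have h2 := (h1.cexp).mul_const (g x)
    convert! h2 using 1
    ring

variable {E : Type*} [NormedAddCommGroup E] [InnerProductSpace ℝ E] [FiniteDimensional ℝ E]
  [MeasurableSpace E] [BorelSpace E]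

/-- The Fourier transform of a compactly supported integrable function is analytic on lines. -/
theorem analyticOnNhd_fourier_line {G : E → ℂ} (hG : Integrable G) {R : ℝ}
    (hR : ∀ᵐ ξ, G ξ ≠ 0 → ‖ξ‖ ≤ R) (p y : E) :
    AnalyticOnNhd ℝ (fun t : ℝ => 𝓕 G (p + t • y)) univ := by
  set a : E → ℂ := fun ξ => ((-2 * Real.pi * inner ℝ ξ y : ℝ) : ℂ) * Complex.I with ha
  set g : E → ℂ := fun ξ => Complex.exp (((-2 * Real.pi * inner ℝ ξ p : ℝ) : ℂ) * Complex.I) * G ξ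
    with hg
  have hac : Continuous a := by fun_prop
  have hgi : Integrable g := by
    refine hG.mono ((Continuous.aestronglyMeasurable (by fun_prop)).mul hG.aestronglyMeasurable) ?_
    filter_upwards with ξ
    rw [hg, norm_mul, Complex.norm_exp_ofReal_mul_I, one_mul]
  have hd : Differentiable ℂ fun z : ℂ => ∫ ξ, Complex.exp (z * a ξ) * g ξ := by
    refine differentiable_integral_cexp (K := 2 * Real.pi * (R * ‖y‖)) hac.aestronglyMeasurable hgi ?_
    filter_upwards [hR] with ξ hξ hne
    have h1 : G ξ ≠ 0 := right_ne_zero_of_mul hne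
    rw [ha, norm_mul, Complex.norm_I, mul_one, Complex.norm_real, norm_mul]
    have h2 : ‖(inner ℝ ξ y : ℝ)‖ ≤ R * ‖y‖ := (norm_inner_le_norm ξ y).trans (by gcongr; exact hξ h1)
    have h3 : ‖-2 * Real.pi‖ = 2 * Real.pi := by
      rw [norm_mul, norm_neg, Real.norm_of_nonneg Real.pi_pos.le]; norm_num
    rw [h3]
    gcongr
  have heq : (fun t : ℝ => 𝓕 G (p + t • y)) =
      (fun z : ℂ => ∫ ξ, Complex.exp (z * a ξ) * g ξ) ∘ Complex.ofRealCLM := by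
    funext t
    rw [Real.fourier_eq']
    refine integral_congr_ae (Eventually.of_forall fun ξ => ?_)
    simp only [ha, hg, Complex.ofRealCLM_apply, smul_eq_mul, ← mul_assoc, ← Complex.exp_add]
    congr 2
    rw [inner_add_right, inner_smul_right]
    push_cast
    ring
  rw [heq]
  intro t _
  exact ((hd.analyticAt _).restrictScalars (𝕜 := ℝ)).comp (Complex.ofRealCLM.analyticAt t)

theorem analyticOnNhd_fourierInv_line {G : E → ℂ} (hG : Integrable G) {R : ℝ}
    (hR : ∀ᵐ ξ, G ξ ≠ 0 → ‖ξ‖ ≤ R) (p y : E) :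
    AnalyticOnNhd ℝ (fun t : ℝ => 𝓕⁻ G (p + t • y)) univ := by
  simp_rw [Real.fourierInv_eq_fourier_neg, neg_add, ← smul_neg]
  exact analyticOnNhd_fourier_line hG hR _ _

/-- If a product of functions that are analytic on lines vanishes, one of the factors does. -/
theorem eq_zero_or_eq_zero_of_analytic_lines {V : Type*} [AddCommGroup V] [Module ℝ V]
    {u w : V → ℂ}
    (hu : ∀ p y, AnalyticOnNhd ℝ (fun t : ℝ => u (p + t • y)) univ)
    (hw : ∀ p y, AnalyticOnNhd ℝ (fun t : ℝ => w (p + t • y)) univ)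
    (huw : ∀ x, u x * w x = 0) : u = 0 ∨ w = 0 := by
  by_contra! h
  obtain ⟨p, hp⟩ := Function.ne_iff.1 h.1
  refine h.2 (funext fun q => ?_)
  have h1 : ∀ᶠ t : ℝ in 𝓝 0, u (p + t • (q - p)) ≠ 0 := by
    refine ((hu p (q - p)).continuousOn.continuousAt univ_mem).eventually_ne ?_
    simpa using hp
  have h2 : (fun t : ℝ => w (p + t • (q - p))) =ᶠ[𝓝 0] fun _ => 0 := by
    filter_upwards [h1] with t ht using (mul_eq_zero.1 (huw _)).resolve_left ht
  have h3 := (hw p (q - p)).eq_of_eventuallyEq analyticOnNhd_const h2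
  simpa using congrFun h3 1

/-- A function that is analytic on lines and vanishes on a set of positive measure is zero. -/
theorem eq_zero_of_analytic_lines_of_volume_ne_zero {h : E → ℂ} (hc : Continuous h)
    (hh : ∀ p y, AnalyticOnNhd ℝ (fun t : ℝ => h (p + t • y)) univ)
    (hZ : volume {x | h x = 0} ≠ 0) : h = 0 := by
  by_contra hne
  obtain ⟨p, hp⟩ := Function.ne_iff.1 hne
  have hmeas : MeasurableSet {q : E × ℝ | h (p + q.2 • q.1) = 0} :=
    (isClosed_eq (by fun_prop) continuous_const).measurableSet
  have hline : ∀ x : E, volume {t : ℝ | h (p + t • x) = 0} = 0 := by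
    intro x
    have h1 := (hh p x).preimage_zero_mem_codiscrete (x := 0) (by simpa using hp)
    have h2 := ae_restrict_le_codiscreteWithin (μ := (volume : Measure ℝ)) MeasurableSet.univ h1
    rw [Measure.restrict_univ, mem_ae_iff] at h2
    simpa [preimage, compl_ofPred] using h2
  have hprod : (volume.prod volume) {q : E × ℝ | h (p + q.2 • q.1) = 0} = 0 := by
    rw [Measure.measure_prod_null hmeas]
    filter_upwards with x using hline x
  rw [← Measure.prod_swap, Measure.map_apply measurable_swap hmeas] at hprod
  have hswap := Measure.measure_ae_null_of_prod_null hprod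
  obtain ⟨t, ht0, ht⟩ : ∃ t : ℝ, t ≠ 0 ∧ volume {x : E | h (p + t • x) = 0} = 0 := by
    have hn : ∀ᵐ t : ℝ, t ≠ 0 := by simp [ae_iff]
    obtain ⟨t, h1, h2⟩ := (hn.and hswap).exists
    exact ⟨t, h1, h2⟩
  apply hZ
  have h1 : {x : E | h (p + t • x) = 0} = (fun x => t • x) ⁻¹' ((fun x => p + x) ⁻¹' {x | h x = 0}) :=
    rfl
  rw [h1, Measure.addHaar_preimage_smul _ ht0, measure_preimage_add] at ht
  simpa [ht0] using ht

end Analytic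

/-! ### Fourier analysis -/

section Fourier

open Filter

variable {E : Type*} [NormedAddCommGroup E] [InnerProductSpace ℝ E] [FiniteDimensional ℝ E]
  [MeasurableSpace E] [BorelSpace E]

theorem continuous_fourier_of_integrable {G : E → ℂ} (hG : Integrable G) : Continuous (𝓕 G) :=
  VectorFourier.fourierIntegral_continuous Real.continuous_fourierChar continuous_inner hG

theorem continuous_fourierInv_of_integrable {G : E → ℂ} (hG : Integrable G) :
    Continuous (𝓕⁻ G) := by
  have : (𝓕⁻ G) = fun x => 𝓕 G (-x) := funext fun x => Real.fourierInv_eq_fourier_neg G x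
  rw [this]
  exact (continuous_fourier_of_integrable hG).comp continuous_neg

theorem integral_fourierInv_mul_eq_flip {f g : E → ℂ} (hf : Integrable f) (hg : Integrable g) :
    ∫ ξ, 𝓕⁻ f ξ * g ξ = ∫ x, f x * 𝓕⁻ g x := by
  have h := VectorFourier.integral_fourierIntegral_smul_eq_flip (L := -innerₗ E)
    (μ := (volume : Measure E)) (ν := (volume : Measure E))
    Real.continuous_fourierChar (by
      change Continuous fun p : E × E => -(inner ℝ p.1 p.2)
      fun_prop) hf hg
  have hflip : (-innerₗ E).flip = -innerₗ E := by
    ext x y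
    simp [real_inner_comm]
  rw [hflip] at h
  exact h

/-- On `L¹ ∩ L²` the inverse Fourier transform on `L²` is given by the Fourier integral. -/
theorem coeFn_fourierInv_toLp {G : E → ℂ} (hG : Integrable G) (hG2 : MemLp G 2) :
    (𝓕⁻ (hG2.toLp G) : Lp ℂ 2 (volume : Measure E)) =ᵐ[volume] 𝓕⁻ G := by
  refine ae_eq_of_integral_contDiff_smul_eq ((Lp.memLp _).locallyIntegrable (by norm_num))
    (continuous_fourierInv_of_integrable hG).locallyIntegrable fun g hg hgc => ?_
  have hg₁ : HasCompactSupport (Complex.ofRealCLM ∘ g) := hgc.comp_left rfl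
  have hg₂ : ContDiff ℝ (⊤ : ℕ∞) (Complex.ofRealCLM ∘ g) := by fun_prop
  set φ := hg₁.toSchwartzMap hg₂ with hφ
  have hφg : ∀ x, φ x = (g x : ℂ) := fun x => rfl
  have h1 := congrArg (fun T => T φ) (Lp.fourierInv_toTemperedDistribution_eq (hG2.toLp G))
  simp only [TemperedDistribution.fourierInv_apply, Lp.toTemperedDistribution_apply] at h1
  calc ∫ x, g x • (𝓕⁻ (hG2.toLp G) : Lp ℂ 2 (volume : Measure E)) x
      = ∫ x, φ x • (𝓕⁻ (hG2.toLp G) : Lp ℂ 2 (volume : Measure E)) x := by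
        simp [hφg]
    _ = ∫ x, (𝓕⁻ φ) x • (hG2.toLp G) x := h1.symm
    _ = ∫ x, 𝓕⁻ (φ : E → ℂ) x * G x := by
        refine integral_congr_ae ?_
        filter_upwards [hG2.coeFn_toLp] with x hx
        rw [hx, smul_eq_mul, SchwartzMap.fourierInv_coe]
    _ = ∫ x, φ x * 𝓕⁻ G x := integral_fourierInv_mul_eq_flip φ.integrable hG
    _ = _ := by simp [hφg]

theorem eLpNorm_fourierInv {G : E → ℂ} (hG : Integrable G) (hG2 : MemLp G 2) :
    eLpNorm (𝓕⁻ G) 2 volume = eLpNorm G 2 volume := by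
  rw [← eLpNorm_congr_ae (coeFn_fourierInv_toLp hG hG2), ← eLpNorm_congr_ae hG2.coeFn_toLp]
  have h : ‖(𝓕⁻ (hG2.toLp G) : Lp ℂ 2 (volume : Measure E))‖ = ‖hG2.toLp G‖ :=
    (Lp.fourierTransformₗᵢ E ℂ).symm.norm_map _
  rw [Lp.norm_def, Lp.norm_def, ENNReal.toReal_eq_toReal_iff' (Lp.eLpNorm_ne_top _)
    (Lp.eLpNorm_ne_top _)] at h
  exact h

open scoped Convolution in
theorem fourierInv_mul_convolution {P Q : E → ℂ} (hP : Integrable P) (hQ : Integrable Q) (x : E) :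
    𝓕⁻ (P ⋆[ContinuousLinearMap.mul ℂ ℂ] Q) x = 𝓕⁻ P x * 𝓕⁻ Q x := by
  simp only [Real.fourierInv_eq_fourier_neg]
  exact Real.fourier_mul_convolution_eq hP hQ (-x)

open scoped Convolution in
theorem norm_mul_convolution_le {P Q : E → ℂ} (hP : MemLp P 2) (hQ : MemLp Q 2) (x : E) :
    ‖(P ⋆[ContinuousLinearMap.mul ℂ ℂ] Q) x‖ ≤
      (eLpNorm P 2 volume).toReal * (eLpNorm Q 2 volume).toReal := by
  have hQx : MemLp (fun t => Q (x - t)) 2 :=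
    hQ.comp_measurePreserving (Measure.measurePreserving_sub_left volume x)
  have hQn : eLpNorm (fun t => Q (x - t)) 2 volume = eLpNorm Q 2 volume :=
    eLpNorm_comp_measurePreserving hQ.1 (Measure.measurePreserving_sub_left volume x)
  refine (norm_integral_le_integral_norm _).trans ?_
  have h := integral_mul_norm_le_Lp_mul_Lq (μ := (volume : Measure E)) (f := P)
    (g := fun t => Q (x - t)) (p := 2) (q := 2) ⟨by norm_num, by norm_num, by norm_num⟩
    (by simpa using hP) (by simpa using hQx)
  have hnorm : ∀ {f : E → ℂ}, MemLp f 2 →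
      (∫ t, ‖f t‖ ^ (2 : ℝ)) ^ ((1 : ℝ) / 2) = (eLpNorm f 2 volume).toReal := fun {f} hf => by
    rw [hf.eLpNorm_eq_integral_rpow_norm two_ne_zero ENNReal.ofNat_ne_top,
      ENNReal.toReal_ofReal (by positivity)]
    simp
  rw [hnorm hP, hnorm hQx, hQn] at h
  simpa using h

open scoped Convolution in
theorem memLp_two_mul_convolution {P Q : E → ℂ} (hP : Integrable P) (hQ : Integrable Q)
    (hP2 : MemLp P 2) (hQ2 : MemLp Q 2) :
    MemLp (P ⋆[ContinuousLinearMap.mul ℂ ℂ] Q) 2 := by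
  have hi := hP.integrable_convolution (ContinuousLinearMap.mul ℂ ℂ) hQ
  rw [memLp_two_iff_integrable_sq_norm hi.aestronglyMeasurable]
  refine (hi.norm.const_mul
    ((eLpNorm P 2 volume).toReal * (eLpNorm Q 2 volume).toReal)).mono'
    (hi.aestronglyMeasurable.norm.pow 2) ?_
  filter_upwards with x
  rw [norm_pow, norm_norm, sq]
  gcongr
  exact norm_mul_convolution_le hP2 hQ2 x

end Fourier

/-! ### Sampling on lattices -/

section Sampling

open Filter

variable {d : ℕ}

theorem mFourier_coe_apply (n : Fin d → ℤ) (x : Fin d → ℝ) :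
    UnitAddTorus.mFourier n (fun i => (x i : UnitAddCircle)) =
      Complex.exp (((2 * Real.pi * ∑ i, (n i : ℝ) * x i : ℝ) : ℂ) * Complex.I) := by
  simp only [UnitAddTorus.mFourier, ContinuousMap.coe_mk, fourier_coe_apply, ← Complex.exp_sum]
  congr 1
  push_cast
  rw [Finset.mul_sum, Finset.sum_mul]
  refine Finset.sum_congr rfl fun i _ => ?_
  ring

attribute [local instance] instMeasureSpaceUnitAddCircle

/-- **Parseval's identity** for the Fourier coefficients of a function supported in the cube. -/
theorem hasSum_sq_fourierCoeff_of_support_cube {g : (Fin d → ℝ) → ℂ} (hg : MemLp g 2)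
    (h0 : ∀ᵐ x, g x ≠ 0 → ∀ i, |x i| ≤ 1 / 2) :
    HasSum (fun n : Fin d → ℤ => ‖∫ x, Complex.exp
        (((2 * Real.pi * ∑ i, (n i : ℝ) * x i : ℝ) : ℂ) * Complex.I) * g x‖ ^ 2)
      (∫ x, ‖g x‖ ^ 2) := by
  set a : Fin d → ℝ := fun _ => -(1 / 2) with ha
  set S : Set (Fin d → ℝ) := {x | ∀ i, x i ∈ Ioc (a i) (a i + 1)} with hS
  have hSm : MeasurableSet S := MeasurableSet.univ_pi' fun i => measurableSet_Ioc
  have hout : ∀ᵐ x, x ∉ S → g x = 0 := by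
    have h1 : S =ᵐ[volume] Icc a (fun i => a i + 1) := by
      have := Measure.univ_pi_Ioc_ae_eq_Icc (μ := fun _ : Fin d => (volume : Measure ℝ)) (f := a)
        (g := fun i => a i + 1)
      have hS' : S = univ.pi fun i => Ioc (a i) (a i + 1) := by
        ext x; simp [hS]
      rw [hS']
      exact this
    filter_upwards [h1.mem_iff, h0] with x hx hx0 hxS
    by_contra hne
    refine hxS (hx.2 ?_)
    have := hx0 hne
    simp only [ha, mem_Icc, Pi.le_def]
    refine ⟨fun i => (abs_le.1 (this i)).1, fun i => ?_⟩
    have := (abs_le.1 (this i)).2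
    linarith
  set τ : UnitAddTorus (Fin d) → ℂ :=
    g ∘ Subtype.val ∘ UnitAddTorus.measurableEquivPiIoc a with hτ
  have hτx : ∀ x ∈ S, τ (fun i => (x i : UnitAddCircle)) = g x := by
    intro x hx
    simp only [hτ, Function.comp_apply, UnitAddTorus.coe_measurableEquivPiIoc_apply]
    congr 1
    funext i
    rw [AddCircle.equivIoc_coe_eq (hx i)]
  have hval : MeasurePreserving (Subtype.val : S → (Fin d → ℝ)) (Measure.comap Subtype.val volume)
      (volume.restrict S) :=
    ⟨measurable_subtype_coe, map_comap_subtype_coe hSm volume⟩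
  have hτL := (hg.restrict S).comp_measurePreserving
    (hval.comp (UnitAddTorus.measurePreserving_equivPiIoc a))
  have hsum := UnitAddTorus.hasSum_sq_mFourierCoeff (hτL.toLp _)
  have hint : ∫ x, ‖g x‖ ^ 2 = ∫ t, ‖(hτL.toLp _) t‖ ^ 2 := by
    have h1 : ∫ t, ‖(hτL.toLp _) t‖ ^ 2 = ∫ t, ‖τ t‖ ^ 2 := by
      refine integral_congr_ae ?_
      filter_upwards [hτL.coeFn_toLp] with t ht
      rw [ht]; rfl
    rw [h1, UnitAddTorus.integral_preimage _ a, ← setIntegral_eq_integral_of_ae_compl_eq_zero (s := S)]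
    · exact setIntegral_congr_fun hSm fun x hx => by simp only [hτx x hx]
    · filter_upwards [hout] with x hx hxS
      simp [hx hxS]
  rw [hint, ← (Equiv.neg (Fin d → ℤ)).hasSum_iff]
  refine hsum.congr_fun fun n => ?_
  have h1 : UnitAddTorus.mFourierCoeff (hτL.toLp _) n = UnitAddTorus.mFourierCoeff τ n := by
    refine integral_congr_ae ?_
    filter_upwards [hτL.coeFn_toLp] with t ht
    rw [ht]; rfl
  rw [h1, UnitAddTorus.mFourierCoeff_eq_integral _ _ a, Function.comp_apply,
    ← setIntegral_eq_integral_of_ae_compl_eq_zero (s := S)]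
  · congr 2
    refine setIntegral_congr_fun hSm fun x hx => ?_
    simp only [hτx x hx, mFourier_coe_apply, smul_eq_mul, Equiv.neg_apply]
  · filter_upwards [hout] with x hx hxS
    simp [hx hxS]

theorem toEuclideanLin_eq_toLp_mulVec (N : Matrix (Fin d) (Fin d) ℝ)
    (x : EuclideanSpace ℝ (Fin d)) :
    Matrix.toEuclideanLin N x = WithLp.toLp 2 (N.mulVec x.ofLp) := rfl

theorem map_toLp_mulVec_volume {N : Matrix (Fin d) (Fin d) ℝ} (hN : N.det ≠ 0) :
    Measure.map (fun η : Fin d → ℝ => (WithLp.toLp 2 (N.mulVec η) : EuclideanSpace ℝ (Fin d)))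
      volume = ENNReal.ofReal |N.det⁻¹| • volume := by
  have h := Real.map_matrix_volume_pi_eq_smul_volume_pi hN
  have hm : Measurable (Matrix.toLin' N) :=
    (LinearMap.continuous_of_finiteDimensional _).measurable
  have hL := PiLp.volume_preserving_toLp (Fin d)
  rw [← hL.map_eq, ← Measure.map_smul, ← h, Measure.map_map hL.measurable hm]
  rfl

theorem measurableEmbedding_toLp_mulVec {N : Matrix (Fin d) (Fin d) ℝ} (hN : N.det ≠ 0) :
    MeasurableEmbedding
      (fun η : Fin d → ℝ => (WithLp.toLp 2 (N.mulVec η) : EuclideanSpace ℝ (Fin d))) := by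
  refine Continuous.measurableEmbedding ?_ ?_
  · exact (PiLp.continuous_toLp 2 _).comp (continuous_const.matrix_mulVec continuous_id)
  · intro x y hxy
    exact Matrix.mulVec_injective_of_isUnit ((Matrix.isUnit_iff_isUnit_det _).2 hN.isUnit)
      (WithLp.toLp_injective 2 hxy)

theorem integral_eq_abs_det_mul_integral_comp_mulVec {V : Type*} [NormedAddCommGroup V]
    [NormedSpace ℝ V] {N : Matrix (Fin d) (Fin d) ℝ} (hN : N.det ≠ 0)
    (G : EuclideanSpace ℝ (Fin d) → V) :
    ∫ ξ, G ξ = |N.det| • ∫ η : Fin d → ℝ, G (WithLp.toLp 2 (N.mulVec η)) := by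
  rw [← (measurableEmbedding_toLp_mulVec hN).integral_map, map_toLp_mulVec_volume hN,
    integral_smul_measure, ENNReal.toReal_ofReal (abs_nonneg _), smul_smul, abs_inv,
    mul_inv_cancel₀ (abs_ne_zero.2 hN), one_smul]

theorem inner_mulVec_dual_lattice {N : Matrix (Fin d) (Fin d) ℝ} (hN : N.det ≠ 0)
    (η n : Fin d → ℝ) :
    inner ℝ (WithLp.toLp 2 (N.mulVec η) : EuclideanSpace ℝ (Fin d))
      (WithLp.toLp 2 ((N.transpose)⁻¹.mulVec n)) = ∑ i, n i * η i := by
  rw [EuclideanSpace.inner_toLp_toLp, star_trivial, Matrix.dotProduct_mulVec,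
    ← Matrix.mulVec_transpose, Matrix.mulVec_mulVec, Matrix.mul_nonsing_inv _
      (by rw [Matrix.det_transpose]; exact hN.isUnit), Matrix.one_mulVec]
  rfl

/-- **Parseval's identity** on the lattice dual to `N ℤᵈ`, for functions with spectrum in the
parallelepiped `N [-1/2, 1/2]ᵈ`. -/
theorem hasSum_sq_fourierInv_lattice {N : Matrix (Fin d) (Fin d) ℝ} (hN : N.det ≠ 0)
    {G : EuclideanSpace ℝ (Fin d) → ℂ} (hG : MemLp G 2)
    (h0 : ∀ᵐ ξ, G ξ ≠ 0 → ξ ∈ (fun x => Matrix.toEuclideanLin N x) '' cube d) :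
    HasSum (fun n : Fin d → ℤ =>
        ‖𝓕⁻ G (WithLp.toLp 2 ((N.transpose)⁻¹.mulVec fun i => (n i : ℝ)))‖ ^ 2)
      (|N.det| * ∫ ξ, ‖G ξ‖ ^ 2) := by
  set Φ : (Fin d → ℝ) → EuclideanSpace ℝ (Fin d) := fun η => WithLp.toLp 2 (N.mulVec η) with hΦ
  have hemb : MeasurableEmbedding Φ := measurableEmbedding_toLp_mulVec hN
  have hmap : Measure.map Φ volume = ENNReal.ofReal |N.det⁻¹| • volume := map_toLp_mulVec_volume hN
  have hGΦ : MemLp (fun η => ((|N.det| : ℝ) : ℂ) * G (Φ η)) 2 := by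
    refine MemLp.const_mul ?_ _
    refine MemLp.comp_of_map (f := Φ) (g := G) ?_ hemb.measurable.aemeasurable
    rw [hmap]
    exact hG.smul_measure ENNReal.ofReal_ne_top
  have h0Φ : ∀ᵐ η, ((|N.det| : ℝ) : ℂ) * G (Φ η) ≠ 0 → ∀ i, |η i| ≤ 1 / 2 := by
    have h1 : ∀ᵐ ξ ∂(Measure.map Φ volume),
        G ξ ≠ 0 → ξ ∈ (fun x => Matrix.toEuclideanLin N x) '' cube d := by
      rw [hmap]
      exact Measure.ae_smul_measure h0 _
    filter_upwards [ae_of_ae_map hemb.measurable.aemeasurable h1] with η hη hne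
    obtain ⟨x, hx, hxη⟩ := hη (right_ne_zero_of_mul hne)
    have : Φ x.ofLp = Φ η := hxη
    rw [← hemb.injective this]
    exact hx
  have hsum := hasSum_sq_fourierCoeff_of_support_cube hGΦ h0Φ
  have hint : ∫ η, ‖((|N.det| : ℝ) : ℂ) * G (Φ η)‖ ^ 2 = |N.det| * ∫ ξ, ‖G ξ‖ ^ 2 := by
    rw [integral_eq_abs_det_mul_integral_comp_mulVec hN, smul_eq_mul, ← mul_assoc,
      ← integral_const_mul]
    refine integral_congr_ae (Eventually.of_forall fun η => ?_)
    simp only [norm_mul, Complex.norm_real, Real.norm_eq_abs, abs_abs, hΦ]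
    ring
  rw [hint] at hsum
  refine hsum.congr_fun fun n => ?_
  rw [Real.fourierInv_eq', integral_eq_abs_det_mul_integral_comp_mulVec hN, ← integral_smul]
  congr 2
  refine integral_congr_ae (Eventually.of_forall fun η => ?_)
  simp only [inner_mulVec_dual_lattice hN, hΦ, smul_eq_mul, Complex.real_smul]
  ring

end Sampling

/-! ### Convolution with band-limited functions -/

section Convolution

open Filter

variable {d : ℕ}

theorem ae_mem_essSupport (g : Lp ℂ 2 (volume : Measure (EuclideanSpace ℝ (Fin d)))) :
    ∀ᵐ ξ, g ξ ≠ 0 → ξ ∈ essSupport g := by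
  have h : volume ((essSupport g)ᶜ ∩ Function.support g) = 0 := by
    refine measure_null_of_locally_null _ fun ξ hξ => ?_
    have h1 := hξ.1
    simp only [essSupport, mem_compl_iff, mem_ofPred_eq, not_forall, not_lt, nonpos_iff_eq_zero] at h1
    obtain ⟨U, hU, hU0⟩ := h1
    refine ⟨U ∩ Function.support g, ?_, hU0⟩
    exact mem_nhdsWithin.2 ⟨interior U, isOpen_interior, mem_interior_iff_mem_nhds.2 hU,
      fun y hy => ⟨interior_subset hy.1, hy.2.2⟩⟩
  rw [ae_iff]
  convert h using 2
  ext ξ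
  simp [and_comm]

theorem integrable_fourierL2 {ψ : Lp ℝ 2 (volume : Measure (EuclideanSpace ℝ (Fin d)))}
    (hψ : IsCompact (fourierSupport ψ)) : Integrable (fourierL2 ψ) := by
  have hon : IntegrableOn (fourierL2 ψ) (fourierSupport ψ) := by
    have : IsFiniteMeasure (volume.restrict (fourierSupport ψ)) :=
      ⟨by simpa using hψ.measure_lt_top⟩
    exact ((Lp.memLp (fourierL2 ψ)).restrict _).integrable (by norm_num)
  refine (hon.integrable_indicator hψ.measurableSet).congr ?_
  filter_upwards [ae_mem_essSupport (fourierL2 ψ)] with ξ hξ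
  by_cases h : ξ ∈ fourierSupport ψ
  · rw [indicator_of_mem h]
  · rw [indicator_of_notMem h]
    by_contra hne
    exact h (hξ (Ne.symm hne))

theorem ofReal_ae_eq_fourierInv_fourierL2
    {ψ : Lp ℝ 2 (volume : Measure (EuclideanSpace ℝ (Fin d)))}
    (hψ : IsCompact (fourierSupport ψ)) :
    (fun x => (ψ x : ℂ)) =ᵐ[volume] 𝓕⁻ (fourierL2 ψ : EuclideanSpace ℝ (Fin d) → ℂ) := by
  have h1 := coeFn_fourierInv_toLp (integrable_fourierL2 hψ) (Lp.memLp (fourierL2 ψ))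
  rw [Lp.toLp_coeFn] at h1
  have h2 : 𝓕⁻ (fourierL2 ψ) = Complex.ofRealCLM.compLp ψ :=
    FourierTransform.fourierInv_fourier_eq _
  rw [h2] at h1
  filter_upwards [Complex.ofRealCLM.coeFn_compLp ψ, h1] with x hx hx'
  rw [← hx', hx]
  rfl

/-- The Fourier transform of `g ∗ ψ`. -/
noncomputable def convSpectrum (g : EuclideanSpace ℝ (Fin d) → ℝ)
    (ψ : Lp ℝ 2 (volume : Measure (EuclideanSpace ℝ (Fin d)))) :
    EuclideanSpace ℝ (Fin d) → ℂ :=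
  fun ξ => 𝓕 (fun t => (g t : ℂ)) ξ * fourierL2 ψ ξ

theorem integral_mul_fourier_eq_flip {f g : EuclideanSpace ℝ (Fin d) → ℂ} (hf : Integrable f)
    (hg : Integrable g) : ∫ ξ, 𝓕 f ξ * g ξ = ∫ x, f x * 𝓕 g x := by
  have h := VectorFourier.integral_fourierIntegral_smul_eq_flip
    (L := innerₗ (EuclideanSpace ℝ (Fin d)))
    (μ := volume) (ν := volume) Real.continuous_fourierChar continuous_inner hf hg
  rw [flip_innerₗ] at h
  exact h

theorem ofReal_conv_eq_fourierInv {ψ : Lp ℝ 2 (volume : Measure (EuclideanSpace ℝ (Fin d)))}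
    (hψ : IsCompact (fourierSupport ψ)) {g : EuclideanSpace ℝ (Fin d) → ℝ} (hg : Integrable g)
    (x : EuclideanSpace ℝ (Fin d)) :
    ((conv g ψ x : ℝ) : ℂ) = 𝓕⁻ (convSpectrum g ψ) x := by
  have hψi := integrable_fourierL2 hψ
  set θ : EuclideanSpace ℝ (Fin d) → ℂ :=
    fun ξ => Complex.exp (((2 * Real.pi * inner ℝ ξ x : ℝ) : ℂ) * Complex.I) * fourierL2 ψ ξ with hθ
  have hθi : Integrable θ := by
    refine hψi.mono
      ((Continuous.aestronglyMeasurable (by fun_prop)).mul hψi.aestronglyMeasurable) ?_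
    filter_upwards with ξ
    rw [hθ, norm_mul, Complex.norm_exp_ofReal_mul_I, one_mul]
  have hsub : ∀ᵐ t, (ψ (x - t) : ℂ) = 𝓕 θ t := by
    filter_upwards [(Measure.measurePreserving_sub_left volume x).quasiMeasurePreserving.ae
      (ofReal_ae_eq_fourierInv_fourierL2 hψ)] with t ht
    rw [ht, Real.fourierInv_eq', Real.fourier_eq']
    refine integral_congr_ae (Eventually.of_forall fun ξ => ?_)
    simp only [hθ, smul_eq_mul, ← mul_assoc, ← Complex.exp_add]
    congr 2
    rw [inner_sub_right]
    push_cast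
    ring
  calc ((conv g ψ x : ℝ) : ℂ) = ∫ t, (g t : ℂ) * 𝓕 θ t := by
        unfold conv convolution
        rw [← integral_complex_ofReal]
        refine integral_congr_ae ?_
        filter_upwards [hsub] with t ht
        rw [← ht]
        simp [mul_comm]
    _ = ∫ ξ, 𝓕 (fun t => (g t : ℂ)) ξ * θ ξ := (integral_mul_fourier_eq_flip hg.ofReal hθi).symm
    _ = 𝓕⁻ (convSpectrum g ψ) x := by
        rw [Real.fourierInv_eq']
        refine integral_congr_ae (Eventually.of_forall fun ξ => ?_)
        simp only [hθ, convSpectrum, smul_eq_mul]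
        ring

theorem norm_convSpectrum_le (g : EuclideanSpace ℝ (Fin d) → ℝ)
    (ψ : Lp ℝ 2 (volume : Measure (EuclideanSpace ℝ (Fin d)))) (ξ : EuclideanSpace ℝ (Fin d)) :
    ‖convSpectrum g ψ ξ‖ ≤ (∫ t, ‖(g t : ℂ)‖) * ‖fourierL2 ψ ξ‖ := by
  rw [convSpectrum, norm_mul]
  gcongr
  exact VectorFourier.norm_fourierIntegral_le_integral_norm _ _ _ _ _

theorem memLp_convSpectrum {ψ : Lp ℝ 2 (volume : Measure (EuclideanSpace ℝ (Fin d)))}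
    {g : EuclideanSpace ℝ (Fin d) → ℝ} (hg : Integrable g) :
    MemLp (convSpectrum g ψ) 2 :=
  (Lp.memLp (fourierL2 ψ)).of_le_mul
    ((continuous_fourier_of_integrable hg.ofReal).aestronglyMeasurable.mul
      (Lp.aestronglyMeasurable _)) (Eventually.of_forall (norm_convSpectrum_le g ψ))

theorem integrable_convSpectrum {ψ : Lp ℝ 2 (volume : Measure (EuclideanSpace ℝ (Fin d)))}
    (hψ : IsCompact (fourierSupport ψ)) {g : EuclideanSpace ℝ (Fin d) → ℝ} (hg : Integrable g) :
    Integrable (convSpectrum g ψ) :=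
  ((integrable_fourierL2 hψ).norm.const_mul _).mono'
    ((continuous_fourier_of_integrable hg.ofReal).aestronglyMeasurable.mul
      (Lp.aestronglyMeasurable _)) (Eventually.of_forall (norm_convSpectrum_le g ψ))

theorem ae_mem_fourierSupport_of_convSpectrum_ne_zero (g : EuclideanSpace ℝ (Fin d) → ℝ)
    (ψ : Lp ℝ 2 (volume : Measure (EuclideanSpace ℝ (Fin d)))) :
    ∀ᵐ ξ, convSpectrum g ψ ξ ≠ 0 → ξ ∈ fourierSupport ψ := by
  filter_upwards [ae_mem_essSupport (fourierL2 ψ)] with ξ hξ hne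
  exact hξ (right_ne_zero_of_mul hne)

theorem eLpNorm_conv_sq {ψ : Lp ℝ 2 (volume : Measure (EuclideanSpace ℝ (Fin d)))}
    (hψ : IsCompact (fourierSupport ψ)) {g : EuclideanSpace ℝ (Fin d) → ℝ} (hg : Integrable g) :
    eLpNorm (conv g ψ) 2 volume ^ 2 = ENNReal.ofReal (∫ ξ, ‖convSpectrum g ψ ξ‖ ^ 2) := by
  have h1 : eLpNorm (conv g ψ) 2 volume = eLpNorm (𝓕⁻ (convSpectrum g ψ)) 2 volume := by
    refine eLpNorm_congr_norm_ae (Eventually.of_forall fun x => ?_)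
    rw [← ofReal_conv_eq_fourierInv hψ hg, Complex.norm_real]
  have hm := memLp_convSpectrum (ψ := ψ) hg
  rw [h1, eLpNorm_fourierInv (integrable_convSpectrum hψ hg) hm,
    hm.eLpNorm_eq_integral_rpow_norm two_ne_zero ENNReal.ofNat_ne_top,
    ← ENNReal.ofReal_pow (by positivity)]
  congr 1
  have hn : 0 ≤ ∫ ξ, ‖convSpectrum g ψ ξ‖ ^ 2 := integral_nonneg fun ξ => by positivity
  simp only [ENNReal.toReal_ofNat, Real.rpow_ofNat]
  rw [← Real.rpow_natCast, ← Real.rpow_mul hn]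
  norm_num

theorem latticePoint_eq {M : Matrix (Fin d) (Fin d) ℝ} {s : Fin d → ℝ} (n : Fin d → ℤ) :
    latticePoint M s n = WithLp.toLp 2
      (((M * Matrix.diagonal fun i => 2 * s i).transpose)⁻¹.mulVec fun i => (n i : ℝ)) := by
  rw [latticePoint, Matrix.transpose_mul, Matrix.mul_inv_rev, Matrix.diagonal_transpose,
    Matrix.mulVec_mulVec]

theorem det_mul_diagonal (M : Matrix (Fin d) (Fin d) ℝ) (s : Fin d → ℝ) :
    (M * Matrix.diagonal fun i => 2 * s i).det = M.det * (2 ^ d * ∏ i, s i) := by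
  rw [Matrix.det_mul, Matrix.det_diagonal, Finset.prod_mul_distrib]
  simp

theorem toEuclideanLin_mem_image_cube {M : Matrix (Fin d) (Fin d) ℝ} {s : Fin d → ℝ}
    (hs : ∀ i, 1 ≤ s i) {x : EuclideanSpace ℝ (Fin d)} (hx : ∀ i, |x i| ≤ 1) :
    Matrix.toEuclideanLin M x ∈
      (fun x => Matrix.toEuclideanLin (M * Matrix.diagonal fun i => 2 * s i) x) '' cube d := by
  have hpos : ∀ i, 0 < 2 * s i := fun i => by linarith [hs i]
  refine ⟨WithLp.toLp 2 fun i => x i / (2 * s i), fun i => ?_, ?_⟩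
  · change |x i / (2 * s i)| ≤ 1 / 2
    rw [abs_div, abs_of_pos (hpos i), div_le_div_iff₀ (hpos i) two_pos]
    nlinarith [hx i, hs i]
  · simp only [toEuclideanLin_eq_toLp_mulVec, ← Matrix.mulVec_mulVec]
    congr 2
    funext i
    rw [Matrix.mulVec_diagonal]
    exact mul_div_cancel₀ _ (hpos i).ne'

/-- The energy of the samples of `g ∗ ψ` on a sign-blind sampling set. -/
theorem hasSum_sq_conv_latticePoint {ψ : Lp ℝ 2 (volume : Measure (EuclideanSpace ℝ (Fin d)))}
    (hψ : IsCompact (fourierSupport ψ)) {M : Matrix (Fin d) (Fin d) ℝ} {s : Fin d → ℝ}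
    (hX : IsSignBlind (fourierSupport ψ) M s)
    {g : EuclideanSpace ℝ (Fin d) → ℝ} (hg : Integrable g) :
    HasSum (fun n => conv g ψ (latticePoint M s n) ^ 2)
      (|M.det| * (2 ^ d * ∏ i, s i) * ∫ ξ, ‖convSpectrum g ψ ξ‖ ^ 2) := by
  have hs : 0 < 2 ^ d * ∏ i, s i :=
    mul_pos (by positivity) (Finset.prod_pos fun i _ => one_pos.trans_le (hX.one_le i))
  have hN := det_mul_diagonal M s
  have h := hasSum_sq_fourierInv_lattice (N := M * Matrix.diagonal fun i => 2 * s i)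
    (by rw [hN]; exact mul_ne_zero hX.det_ne_zero hs.ne') (memLp_convSpectrum (ψ := ψ) hg) (by
      filter_upwards [ae_mem_fourierSupport_of_convSpectrum_ne_zero g ψ] with ξ hξ hne
      obtain ⟨x, hx, rfl⟩ := hX.subset (hξ hne)
      exact toEuclideanLin_mem_image_cube hX.one_le fun i => (hx i).trans (by norm_num))
  rw [hN, abs_mul, abs_of_pos hs] at h
  refine h.congr_fun fun n => ?_
  rw [← latticePoint_eq, ← ofReal_conv_eq_fourierInv hψ hg, Complex.norm_real, Real.norm_eq_abs,
    sq_abs]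

theorem isCompact_image_cube (M : Matrix (Fin d) (Fin d) ℝ) :
    IsCompact ((fun x => Matrix.toEuclideanLin M x) '' cube d) := by
  refine IsCompact.image ?_ (LinearMap.continuous_of_finiteDimensional _)
  have h : cube d = WithLp.toLp 2 '' (Icc (fun _ => -(1 / 2)) (fun _ => 1 / 2) : Set (Fin d → ℝ)) := by
    ext x
    constructor
    · intro hx
      exact ⟨x.ofLp, ⟨fun i => (abs_le.1 (hx i)).1, fun i => (abs_le.1 (hx i)).2⟩, rfl⟩
    · rintro ⟨y, hy, rfl⟩ i
      exact abs_le.2 ⟨hy.1 i, hy.2 i⟩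
  rw [h]
  exact isCompact_Icc.image (PiLp.continuous_toLp 2 _)

theorem volume_image_cube {M : Matrix (Fin d) (Fin d) ℝ} :
    volume ((fun x => Matrix.toEuclideanLin M x) '' cube d) = ENNReal.ofReal |M.det| := by
  have h : cube d = (MeasurableEquiv.toLp 2 (Fin d → ℝ)).symm ⁻¹'
      (Icc (fun _ => -(1 / 2)) (fun _ => 1 / 2) : Set (Fin d → ℝ)) := by
    ext x
    constructor
    · intro hx
      exact ⟨fun i => (abs_le.1 (hx i)).1, fun i => (abs_le.1 (hx i)).2⟩
    · intro hy i
      exact abs_le.2 ⟨hy.1 i, hy.2 i⟩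
  have hvol : volume (cube d) = 1 := by
    rw [h, (EuclideanSpace.volume_preserving_symm_measurableEquiv_toLp (Fin d)).measure_preimage
      measurableSet_Icc.nullMeasurableSet, Real.volume_Icc_pi]
    norm_num
  rw [Measure.addHaar_image_linearMap, hvol, mul_one]
  rw [Matrix.toEuclideanLin_eq_toLin_orthonormal, LinearMap.det_toLin]

/-- A product of two functions with spectrum in `M [-1/2, 1/2]ᵈ` is determined by its samples on a
sign-blind sampling set. -/
theorem fourierInv_mul_fourierInv_eq_zero {M : Matrix (Fin d) (Fin d) ℝ} {s : Fin d → ℝ}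
    (hM : M.det ≠ 0) (hs : ∀ i, 1 ≤ s i) {P Q : EuclideanSpace ℝ (Fin d) → ℂ}
    (hP : Integrable P) (hP2 : MemLp P 2) (hQ : Integrable Q) (hQ2 : MemLp Q 2)
    (hPM : ∀ᵐ ξ, P ξ ≠ 0 → ξ ∈ (fun x => Matrix.toEuclideanLin M x) '' cube d)
    (hQM : ∀ᵐ ξ, Q ξ ≠ 0 → ξ ∈ (fun x => Matrix.toEuclideanLin M x) '' cube d)
    (h : ∀ n, 𝓕⁻ P (latticePoint M s n) * 𝓕⁻ Q (latticePoint M s n) = 0)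
    (x : EuclideanSpace ℝ (Fin d)) : 𝓕⁻ P x * 𝓕⁻ Q x = 0 := by
  set S := (fun x => Matrix.toEuclideanLin M x) '' cube d with hS
  have hSm : MeasurableSet S := (isCompact_image_cube M).measurableSet
  have hind : ∀ {R : EuclideanSpace ℝ (Fin d) → ℂ}, (∀ᵐ ξ, R ξ ≠ 0 → ξ ∈ S) →
      R =ᵐ[volume] S.indicator R := fun {R} hR => by
    filter_upwards [hR] with ξ hξ
    by_cases hm : ξ ∈ S
    · rw [indicator_of_mem hm]
    · rw [indicator_of_notMem hm]
      by_contra hne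
      exact hm (hξ hne)
  have hPi := hP.indicator hSm
  have hQi := hQ.indicator hSm
  set H := convolution (S.indicator P) (S.indicator Q) (ContinuousLinearMap.mul ℂ ℂ) volume with hH
  have hHF : ∀ y, 𝓕⁻ H y = 𝓕⁻ P y * 𝓕⁻ Q y := fun y => by
    rw [hH, fourierInv_mul_convolution hPi hQi, Real.fourierInv_congr_ae (hind hPM),
      Real.fourierInv_congr_ae (hind hQM)]
  have hH2 : MemLp H 2 :=
    memLp_two_mul_convolution hPi hQi (hP2.indicator hSm) (hQ2.indicator hSm)
  have hsp : 0 < 2 ^ d * ∏ i, s i :=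
    mul_pos (by positivity) (Finset.prod_pos fun i _ => one_pos.trans_le (hs i))
  have hN : (M * Matrix.diagonal fun i => 2 * s i).det ≠ 0 := by
    rw [det_mul_diagonal]
    exact mul_ne_zero hM hsp.ne'
  have hsum := hasSum_sq_fourierInv_lattice hN hH2 (by
    filter_upwards with ξ hξ
    obtain ⟨a, ha, b, hb, rfl⟩ := support_convolution_subset _ hξ
    replace ha := support_indicator_subset ha
    replace hb := support_indicator_subset hb
    obtain ⟨a, ha, rfl⟩ := ha
    obtain ⟨b, hb, rfl⟩ := hb
    simp only [← map_add]
    refine toEuclideanLin_mem_image_cube hs fun i => (abs_add_le _ _).trans ?_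
    have h1 := ha i
    have h2 := hb i
    change |a i| + |b i| ≤ 1
    linarith)
  simp only [← latticePoint_eq, hHF, h, norm_zero, zero_pow two_ne_zero] at hsum
  have h0 := hsum.unique hasSum_zero
  rcases mul_eq_zero.1 h0 with h1 | h1
  · exact absurd (abs_eq_zero.1 h1) hN
  · rw [integral_eq_zero_iff_of_nonneg (fun ξ => by positivity)
      (hH2.integrable_norm_pow two_ne_zero)] at h1
    have h2 : H =ᵐ[volume] fun _ => 0 := by
      filter_upwards [h1] with ξ hξ
      simpa using hξ
    rw [← hHF, Real.fourierInv_congr_ae h2, Real.fourierInv_eq]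
    simp

end Convolution

/-! ### The sampling operator -/

section Operator

open Filter

variable {d : ℕ} {Λ : Type*} {C : Set (EuclideanSpace ℝ (Fin d))}

theorem memLp_indicator (hC : IsCompact C) (f : L2On C) : MemLp (C.indicator f) 2 volume :=
  (memLp_indicator_iff_restrict hC.measurableSet).2 (Lp.memLp f)

theorem integrable_indicator (hC : IsCompact C) (f : L2On C) : Integrable (C.indicator f) := by
  have : IsFiniteMeasure (volume.restrict C) := ⟨by simpa using hC.measure_lt_top⟩
  exact (integrable_indicator_iff hC.measurableSet).2 ((Lp.memLp f).integrable (by norm_num))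

theorem memLp_comp_sub_left (ψ : Lp ℝ 2 (volume : Measure (EuclideanSpace ℝ (Fin d))))
    (C : Set (EuclideanSpace ℝ (Fin d))) (x : EuclideanSpace ℝ (Fin d)) :
    MemLp (fun t => ψ (x - t)) 2 (volume.restrict C) :=
  ((Lp.memLp ψ).comp_measurePreserving (Measure.measurePreserving_sub_left volume x)).restrict C

/-- The functional `f ↦ (f ∗ ψ)(x)` on `L²(C, ℝ)`. -/
noncomputable def convFunctional (ψ : Lp ℝ 2 (volume : Measure (EuclideanSpace ℝ (Fin d))))
    (C : Set (EuclideanSpace ℝ (Fin d))) (x : EuclideanSpace ℝ (Fin d)) : L2On C →L[ℝ] ℝ :=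
  innerSL ℝ ((memLp_comp_sub_left ψ C x).toLp)

theorem convFunctional_apply (hC : IsCompact C)
    (ψ : Lp ℝ 2 (volume : Measure (EuclideanSpace ℝ (Fin d)))) (x : EuclideanSpace ℝ (Fin d))
    (f : L2On C) : convFunctional ψ C x f = convOn f ψ x := by
  rw [convFunctional, innerSL_apply_apply, L2.inner_def]
  unfold convOn conv convolution
  refine Eq.trans ?_ (setIntegral_eq_integral_of_forall_compl_eq_zero (s := C) ?_)
  · refine integral_congr_ae ?_
    filter_upwards [(memLp_comp_sub_left ψ C x).coeFn_toLp, ae_restrict_mem hC.measurableSet]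
      with t ht htC
    rw [ht, indicator_of_mem htC]
    simp [mul_comm]
  · intro t ht
    simp [indicator_of_notMem ht]

/-- The energy `‖f ∗ ψ‖²` of the convolution, computed on the Fourier side. -/
noncomputable def convEnergy (ψ : Lp ℝ 2 (volume : Measure (EuclideanSpace ℝ (Fin d))))
    (f : L2On C) : ℝ :=
  ∫ ξ, ‖convSpectrum (C.indicator f) ψ ξ‖ ^ 2

theorem convEnergy_nonneg (ψ : Lp ℝ 2 (volume : Measure (EuclideanSpace ℝ (Fin d))))
    (f : L2On C) : 0 ≤ convEnergy ψ f :=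
  integral_nonneg fun ξ => by positivity

theorem frame_bounds {ψ : Λ → Lp ℝ 2 (volume : Measure (EuclideanSpace ℝ (Fin d)))}
    (hψ : IsBandLimitedFrame ψ) (hC : IsCompact C) :
    ∃ A : ℝ, 0 < A ∧ ∀ f : L2On C, Summable (fun l => convEnergy (ψ l) f) ∧
      A * ‖f‖ ^ 2 ≤ ∑' l, convEnergy (ψ l) f := by
  obtain ⟨A, B, hA, hB, hAB⟩ := hψ.frame
  refine ⟨A, hA, fun f => ?_⟩
  have hm : MemLp (fun x => ((C.indicator f x : ℝ) : ℂ)) 2 volume := (memLp_indicator hC f).ofReal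
  have hnorm : ‖hm.toLp‖ = ‖f‖ := by
    rw [Lp.norm_toLp, Lp.norm_def, ← eLpNorm_indicator_eq_eLpNorm_restrict hC.measurableSet]
    congr 1
    exact eLpNorm_congr_norm_ae (Eventually.of_forall fun x => Complex.norm_real _)
  have hconv : ∀ l, eLpNorm (conv hm.toLp (ψ l)) 2 volume ^ 2 =
      ENNReal.ofReal (convEnergy (ψ l) f) := by
    intro l
    rw [convEnergy, ← eLpNorm_conv_sq (hψ.bandLimited l) (integrable_indicator hC f)]
    congr 1
    refine eLpNorm_congr_norm_ae (Eventually.of_forall fun x => ?_)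
    rw [← Complex.norm_real (conv (C.indicator f) (ψ l) x)]
    congr 1
    unfold conv convolution
    rw [← integral_complex_ofReal]
    refine integral_congr_ae ?_
    filter_upwards [hm.coeFn_toLp] with t ht
    simp [ht]
  have h := hAB hm.toLp
  simp only [hconv, hnorm] at h
  have hne : ∑' l, ENNReal.ofReal (convEnergy (ψ l) f) ≠ ⊤ :=
    (h.2.trans_lt ENNReal.ofReal_lt_top).ne
  have hs : Summable fun l => convEnergy (ψ l) f := by
    refine (ENNReal.summable_toReal hne).congr fun l => ?_
    rw [ENNReal.toReal_ofReal (convEnergy_nonneg _ _)]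
  refine ⟨hs, ?_⟩
  rw [← ENNReal.ofReal_tsum_of_nonneg (fun l => convEnergy_nonneg _ _) hs] at h
  exact (ENNReal.ofReal_le_ofReal_iff (tsum_nonneg fun l => convEnergy_nonneg _ _)).1 h.1

theorem volume_fourierSupport_pos {ψ : Λ → Lp ℝ 2 (volume : Measure (EuclideanSpace ℝ (Fin d)))}
    (hψ : IsBandLimitedFrame ψ) (ho : GoodFSupportOverlap ψ) (l : Λ) :
    0 < volume.real (fourierSupport (ψ l)) := by
  obtain ⟨U, hU, -⟩ := ho
  exact ENNReal.toReal_pos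
    (((hU l).2.1.measure_pos volume (hU l).1).trans_le (measure_mono (hU l).2.2)).ne'
    (hψ.bandLimited l).measure_lt_top.ne

/-- If `k ∗ ψ_l` vanishes for a single `l`, then `k` vanishes. -/
theorem eq_zero_of_fourierInv_convSpectrum_eq_zero
    {ψ : Λ → Lp ℝ 2 (volume : Measure (EuclideanSpace ℝ (Fin d)))}
    (hψ : IsBandLimitedFrame ψ) (hC : IsCompact C) {l : Λ} (hl : (fourierSupport (ψ l)).Nonempty)
    {k : L2On C} (hk : 𝓕⁻ (convSpectrum (C.indicator k) (ψ l)) = 0) : k = 0 := by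
  have hki : Integrable (fun x => ((C.indicator k x : ℝ) : ℂ)) := (integrable_indicator hC k).ofReal
  have hae : convSpectrum (C.indicator k) (ψ l) =ᵐ[volume] 0 := by
    have hm := memLp_convSpectrum (ψ := ψ l) (integrable_indicator hC k)
    have h1 := eLpNorm_fourierInv
      (integrable_convSpectrum (hψ.bandLimited l) (integrable_indicator hC k)) hm
    rw [hk, eLpNorm_zero] at h1
    exact (eLpNorm_eq_zero_iff hm.1 two_ne_zero).1 h1.symm
  have hpos : volume {ξ | 𝓕 (fun x => ((C.indicator k x : ℝ) : ℂ)) ξ = 0} ≠ 0 := by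
    obtain ⟨ξ, hξ⟩ := hl
    have h1 := hξ univ univ_mem
    rw [univ_inter] at h1
    refine (h1.trans_le (measure_mono_ae ?_)).ne'
    filter_upwards [hae] with η hη hne
    exact (mul_eq_zero.1 hη).resolve_right hne
  obtain ⟨R, hR⟩ := hC.isBounded.exists_norm_le
  have hzero := eq_zero_of_analytic_lines_of_volume_ne_zero (continuous_fourier_of_integrable hki)
    (analyticOnNhd_fourier_line hki (R := R) (Eventually.of_forall fun x hx => hR x (by
      by_contra hxC
      simp [indicator_of_notMem hxC] at hx))) hpos
  obtain ⟨A, hA, hfr⟩ := frame_bounds hψ hC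
  have h1 := (hfr k).2
  have h2 : ∀ l, convEnergy (ψ l) k = 0 := fun l => by
    simp [convEnergy, convSpectrum, hzero]
  simp only [h2, tsum_zero] at h1
  have h3 : ‖k‖ ^ 2 ≤ 0 := by
    by_contra! h
    exact absurd h1 (not_le.2 (mul_pos hA h))
  exact norm_eq_zero.1 (pow_eq_zero_iff two_ne_zero |>.1 (le_antisymm h3 (sq_nonneg _)))

/-- The unsigned samples of `f ∗ ψ_l` for a single `l` determine `f` up to a global sign. -/
theorem eq_or_eq_neg_of_abs_convOn_eq
    {ψ : Λ → Lp ℝ 2 (volume : Measure (EuclideanSpace ℝ (Fin d)))}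
    (hψ : IsBandLimitedFrame ψ) (hC : IsCompact C) {l : Λ} (hl : (fourierSupport (ψ l)).Nonempty)
    {M : Matrix (Fin d) (Fin d) ℝ} {s : Fin d → ℝ} (hX : IsSignBlind (fourierSupport (ψ l)) M s)
    {f g : L2On C}
    (hfg : ∀ n, |convOn f (ψ l) (latticePoint M s n)| = |convOn g (ψ l) (latticePoint M s n)|) :
    f = g ∨ f = -g := by
  have hb := hψ.bandLimited l
  have hconv : ∀ (k : L2On C) x,
      (convFunctional (ψ l) C x k : ℂ) = 𝓕⁻ (convSpectrum (C.indicator k) (ψ l)) x := fun k x => by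
    rw [convFunctional_apply hC, convOn, ofReal_conv_eq_fourierInv hb (integrable_indicator hC k)]
  have hsupp : ∀ k : L2On C, ∀ᵐ ξ, convSpectrum (C.indicator k) (ψ l) ξ ≠ 0 →
      ξ ∈ (fun x => Matrix.toEuclideanLin M x) '' cube d := fun k => by
    filter_upwards [ae_mem_fourierSupport_of_convSpectrum_ne_zero (C.indicator k) (ψ l)]
      with ξ hξ hne using hX.subset (hξ hne)
  have hprod := fourierInv_mul_fourierInv_eq_zero hX.det_ne_zero hX.one_le
    (integrable_convSpectrum hb (integrable_indicator hC (f - g)))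
    (memLp_convSpectrum (integrable_indicator hC (f - g)))
    (integrable_convSpectrum hb (integrable_indicator hC (f + g)))
    (memLp_convSpectrum (integrable_indicator hC (f + g))) (hsupp _) (hsupp _) (fun n => by
      rw [← hconv, ← hconv, map_sub, map_add, convFunctional_apply hC, convFunctional_apply hC,
        ← Complex.ofReal_mul, Complex.ofReal_eq_zero]
      have := (sq_eq_sq_iff_abs_eq_abs _ _).2 (hfg n)
      linear_combination this)
  obtain ⟨R, hR⟩ := hb.isBounded.exists_norm_le
  have hline : ∀ (k : L2On C) p y, AnalyticOnNhd ℝ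
      (fun t : ℝ => 𝓕⁻ (convSpectrum (C.indicator k) (ψ l)) (p + t • y)) univ := fun k =>
    analyticOnNhd_fourierInv_line (integrable_convSpectrum hb (integrable_indicator hC k)) (R := R) (by
      filter_upwards [ae_mem_fourierSupport_of_convSpectrum_ne_zero (C.indicator k) (ψ l)]
        with ξ hξ hne using hR ξ (hξ hne))
  rcases eq_zero_or_eq_zero_of_analytic_lines (hline _) (hline _) hprod with h | h
  · exact Or.inl (sub_eq_zero.1 (eq_zero_of_fourierInv_convSpectrum_eq_zero hψ hC hl h))
  · exact Or.inr (eq_neg_of_add_eq_zero_left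
      (eq_zero_of_fourierInv_convSpectrum_eq_zero hψ hC hl h))

/-- The functional whose absolute value is a sample. -/
noncomputable def sampleFunctional (ψ : Λ → Lp ℝ 2 (volume : Measure (EuclideanSpace ℝ (Fin d))))
    (M : Λ → Matrix (Fin d) (Fin d) ℝ) (s : Λ → Fin d → ℝ)
    (C : Set (EuclideanSpace ℝ (Fin d))) (p : Λ × (Fin d → ℤ)) : L2On C →L[ℝ] ℝ :=
  (volume.real (fourierSupport (ψ p.1)) ^ (-(1 / 2) : ℝ)) •
    convFunctional (ψ p.1) C (latticePoint (M p.1) (s p.1) p.2)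

theorem samples_eq_abs (ψ : Λ → Lp ℝ 2 (volume : Measure (EuclideanSpace ℝ (Fin d))))
    (M : Λ → Matrix (Fin d) (Fin d) ℝ) (s : Λ → Fin d → ℝ) (hC : IsCompact C) (f : L2On C)
    (p : Λ × (Fin d → ℤ)) : samples ψ M s f p = |sampleFunctional ψ M s C p f| := by
  rw [samples, sampleFunctional, smul_apply, smul_eq_mul, abs_mul,
    abs_of_nonneg (Real.rpow_nonneg measureReal_nonneg _), convFunctional_apply hC]

variable {ψ : Λ → Lp ℝ 2 (volume : Measure (EuclideanSpace ℝ (Fin d)))}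
  {M : Λ → Matrix (Fin d) (Fin d) ℝ} {s : Λ → Fin d → ℝ}

theorem hasSum_sq_sampleFunctional (hψ : IsBandLimitedFrame ψ)
    (hX : ∀ l, IsSignBlind (fourierSupport (ψ l)) (M l) (s l)) (hC : IsCompact C) (f : L2On C)
    (l : Λ) :
    HasSum (fun n => sampleFunctional ψ M s C (l, n) f ^ 2)
      ((volume.real (fourierSupport (ψ l)))⁻¹ * (|(M l).det| * (2 ^ d * ∏ i, s l i)) *
        convEnergy (ψ l) f) := by
  have h := (hasSum_sq_conv_latticePoint (hψ.bandLimited l) (hX l)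
    (integrable_indicator hC f)).mul_left (volume.real (fourierSupport (ψ l)))⁻¹
  rw [← mul_assoc] at h
  refine h.congr_fun fun n => ?_
  simp only [sampleFunctional, smul_apply, smul_eq_mul, mul_pow,
    convFunctional_apply hC, convOn]
  congr 1
  rw [← Real.rpow_natCast, ← Real.rpow_mul measureReal_nonneg, ← Real.rpow_neg_one]
  norm_num

theorem sample_density_ge_one (hψ : IsBandLimitedFrame ψ) (ho : GoodFSupportOverlap ψ)
    (hX : ∀ l, IsSignBlind (fourierSupport (ψ l)) (M l) (s l)) (l : Λ) :
    1 ≤ (volume.real (fourierSupport (ψ l)))⁻¹ * (|(M l).det| * (2 ^ d * ∏ i, s l i)) := by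
  have hpos := volume_fourierSupport_pos hψ ho l
  have h1 : volume.real (fourierSupport (ψ l)) ≤ |(M l).det| := by
    refine ENNReal.toReal_le_of_le_ofReal (abs_nonneg _) ?_
    rw [← volume_image_cube]
    exact measure_mono (hX l).subset
  have h2 : 1 ≤ 2 ^ d * ∏ i, s l i :=
    one_le_mul_of_one_le_of_one_le (one_le_pow₀ one_le_two)
      (Finset.one_le_prod fun i _ => (hX l).one_le i)
  rw [inv_mul_eq_div, one_le_div hpos]
  nlinarith [abs_nonneg (M l).det]

theorem summable_sq_sampleFunctional_iff (hψ : IsBandLimitedFrame ψ)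
    (hX : ∀ l, IsSignBlind (fourierSupport (ψ l)) (M l) (s l)) (hC : IsCompact C) (f : L2On C) :
    Summable (fun p => sampleFunctional ψ M s C p f ^ 2) ↔
      Summable fun l => (volume.real (fourierSupport (ψ l)))⁻¹ *
        (|(M l).det| * (2 ^ d * ∏ i, s l i)) * convEnergy (ψ l) f := by
  rw [summable_prod_of_nonneg fun p => sq_nonneg _]
  simp only [(hasSum_sq_sampleFunctional hψ hX hC f _).tsum_eq,
    (hasSum_sq_sampleFunctional hψ hX hC f _).summable, implies_true, true_and]

theorem exists_le_tsum_sq_sampleFunctional (hψ : IsBandLimitedFrame ψ)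
    (ho : GoodFSupportOverlap ψ) (hX : ∀ l, IsSignBlind (fourierSupport (ψ l)) (M l) (s l))
    (hC : IsCompact C) :
    ∃ A : ℝ, 0 < A ∧ ∀ f : L2On C, Summable (fun p => sampleFunctional ψ M s C p f ^ 2) →
      A * ‖f‖ ^ 2 ≤ ∑' p, sampleFunctional ψ M s C p f ^ 2 := by
  obtain ⟨A, hA, hfr⟩ := frame_bounds hψ hC
  refine ⟨A, hA, fun f hf => (hfr f).2.trans ?_⟩
  rw [hf.tsum_prod]
  simp only [(hasSum_sq_sampleFunctional hψ hX hC f _).tsum_eq]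
  refine (hfr f).1.tsum_le_tsum (fun l => ?_) ((summable_sq_sampleFunctional_iff hψ hX hC f).1 hf)
  exact le_mul_of_one_le_left (convEnergy_nonneg _ _) (sample_density_ge_one hψ ho hX l)

theorem memℓp_samples_iff (hC : IsCompact C) (f : L2On C) :
    Memℓp (samples ψ M s f) 2 ↔ Summable fun p => sampleFunctional ψ M s C p f ^ 2 := by
  rw [memℓp_gen_iff (by norm_num)]
  simp [samples_eq_abs ψ M s hC]

theorem samplingDomain_eq_univ (hψ : IsBandLimitedFrame ψ) (ho : GoodFSupportOverlap ψ)
    (hX : ∀ l, IsSignBlind (fourierSupport (ψ l)) (M l) (s l)) (hC : IsCompact C) {K : ℝ}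
    (hK : ∀ l, |(M l).det| * ∏ i, s l i ≤ K * volume.real (fourierSupport (ψ l))) :
    samplingDomain ψ M s hC = univ := by
  refine eq_univ_of_forall ?_
  rintro ⟨f⟩
  refine (memℓp_samples_iff hC f).2 ((summable_sq_sampleFunctional_iff hψ hX hC f).2 ?_)
  obtain ⟨A, -, hfr⟩ := frame_bounds hψ hC
  refine Summable.of_nonneg_of_le (fun l => mul_nonneg
    (zero_le_one.trans (sample_density_ge_one hψ ho hX l)) (convEnergy_nonneg _ _)) (fun l => ?_)
    ((hfr f).1.mul_left (2 ^ d * K))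
  refine mul_le_mul_of_nonneg_right ?_ (convEnergy_nonneg _ _)
  have hpos := volume_fourierSupport_pos hψ ho l
  rw [inv_mul_le_iff₀ hpos]
  calc |(M l).det| * (2 ^ d * ∏ i, s l i) = 2 ^ d * (|(M l).det| * ∏ i, s l i) := by ring
    _ ≤ 2 ^ d * (K * volume.real (fourierSupport (ψ l))) := 
        mul_le_mul_of_nonneg_left (hK l) (by positivity)
    _ = _ := by ring

theorem samplingOp_injective (hψ : IsBandLimitedFrame ψ) (ho : GoodFSupportOverlap ψ)
    (hX : ∀ l, IsSignBlind (fourierSupport (ψ l)) (M l) (s l)) (hC : IsCompact C) :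
    Function.Injective (samplingOp ψ M s hC) := by
  rintro ⟨⟨f⟩, hf⟩ ⟨⟨g⟩, hg⟩ h
  obtain ⟨U, hU, hcover⟩ := ho
  obtain ⟨l, -⟩ := mem_iUnion.1 (hcover.symm ▸ mem_univ (0 : EuclideanSpace ℝ (Fin d)))
  have hpos := volume_fourierSupport_pos hψ ⟨U, hU, hcover⟩ l
  refine Subtype.ext (Quotient.sound (eq_or_eq_neg_of_abs_convOn_eq hψ hC
    ((hU l).1.mono (hU l).2.2) (hX l) fun n => ?_))
  have h1 : samples ψ M s f (l, n) = samples ψ M s g (l, n) :=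
    congrFun (congrArg Subtype.val h) (l, n)
  exact mul_left_cancel₀ (Real.rpow_pos_of_pos hpos _).ne' h1

theorem continuous_signQuotient_mk {V : Type*} [NormedAddCommGroup V] :
    Continuous (SignQuotient.mk : V → SignQuotient V) := by
  refine LipschitzWith.continuous (K := 1) (LipschitzWith.of_dist_le_mul fun f g => ?_)
  rw [SignQuotient.dist_mk, dist_eq_norm, NNReal.coe_one, one_mul]
  exact min_le_left _ _

theorem isClosed_image_samplingOp (hψ : IsBandLimitedFrame ψ) (ho : GoodFSupportOverlap ψ)
    (hX : ∀ l, IsSignBlind (fourierSupport (ψ l)) (M l) (s l)) (hC : IsCompact C)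
    {A : Set (SignQuotient (L2On C))} (hA : IsClosed A) :
    IsClosed (samplingOp ψ M s hC '' (Subtype.val ⁻¹' A)) := by
  obtain ⟨c, hc, hlow⟩ := exists_le_tsum_sq_sampleFunctional hψ ho hX hC
  convert isClosed_abs_coefficients (sampleFunctional ψ M s C) hc hlow
    (hA.preimage continuous_signQuotient_mk) using 1
  ext x
  constructor
  · rintro ⟨⟨⟨f⟩, hf⟩, hfA, rfl⟩
    exact ⟨f, hfA, fun p => samples_eq_abs ψ M s hC f p⟩
  · rintro ⟨f, hfA, hx⟩
    have hxs : (x : Λ × (Fin d → ℤ) → ℝ) = samples ψ M s f :=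
      funext fun p => (hx p).trans (samples_eq_abs ψ M s hC f p).symm
    refine ⟨⟨SignQuotient.mk f, ?_⟩, hfA, Subtype.ext hxs.symm⟩
    change Memℓp (samples ψ M s f) 2
    rw [← hxs]
    exact lp.memℓp x

end Operator

end SignRetrieval

theorem theorem5p1 {d : ℕ} {Λ : Type*}
    (ψ : Λ → Lp ℝ 2 (volume : Measure (EuclideanSpace ℝ (Fin d))))
    (hψ : SignRetrieval.IsBandLimitedFrame ψ)
    (hoverlap : SignRetrieval.GoodFSupportOverlap ψ)
    (M : Λ → Matrix (Fin d) (Fin d) ℝ) (s : Λ → Fin d → ℝ)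
    (hX : ∀ l, SignRetrieval.IsSignBlind (SignRetrieval.fourierSupport (ψ l)) (M l) (s l))
    (C : Set (EuclideanSpace ℝ (Fin d))) (hC : IsCompact C) :
    -- `T` is defined on all of `L²(C, ℝ) / {-1, 1}` if the sampling densities are comparable
    -- to the measures `|F_λ|`
    ((∃ K : ℝ, ∀ l, |(M l).det| * ∏ i, s l i ≤
        K * volume.real (SignRetrieval.fourierSupport (ψ l))) →
      SignRetrieval.samplingDomain ψ M s hC = univ) ∧
    -- `T` is injective, its range is closed, and its inverse on the range is continuous
    ∃ hinj : Function.Injective (SignRetrieval.samplingOp ψ M s hC),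
      IsClosed (range (SignRetrieval.samplingOp ψ M s hC)) ∧
      Continuous fun h : range (SignRetrieval.samplingOp ψ M s hC) =>
        (((Equiv.ofInjective (SignRetrieval.samplingOp ψ M s hC) hinj).symm h :
          SignRetrieval.samplingDomain ψ M s hC) :
            SignRetrieval.SignQuotient (SignRetrieval.L2On C)) := by
  refine ⟨fun ⟨K, hK⟩ => SignRetrieval.samplingDomain_eq_univ hψ hoverlap hX hC hK,
    SignRetrieval.samplingOp_injective hψ hoverlap hX hC, ?_, ?_⟩
  · have h := SignRetrieval.isClosed_image_samplingOp hψ hoverlap hX hC isClosed_univ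
    rwa [preimage_univ, image_univ] at h
  · rw [continuous_iff_isClosed]
    intro A hA
    have h := SignRetrieval.isClosed_image_samplingOp hψ hoverlap hX hC hA
    convert h.preimage continuous_subtype_val using 1
    ext ⟨y, q, rfl⟩
    have hinj := SignRetrieval.samplingOp_injective hψ hoverlap hX hC
    rw [mem_preimage, mem_preimage, hinj.mem_set_image, mem_preimage,
      Equiv.ofInjective_symm_apply]
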